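/- Let $n\ge 3$, let $\Phi=\{\pm e_a\pm e_b: a<b\}\subset\mathbb R^n$ be the root system of type $D_n$, $\Phi^+=\{e_a\pm e_b:a<b\}$, with simple roots $\alpha_k=e_k-e_{k+1}$ ($k<n$) and $\alpha_n=e_{n-1}+e_n$, and put $\alpha_{ij}=\alpha_i+\dots+\alpha_j$ (zero if $j<i$). Let $W$ be the group generated by the reflections in the roots and $N(w)=\Phi^+\cap w(\Phi^-)$. The Shi arrangement consists of the hyperplanes $\langle\alpha,x\rangle=k$, $\alpha\in\Phi^+$, $k\in\{0,1\}$; its regions are the connected components of the complement; $C_e=\{x:\langle\alpha,x\rangle>0\ \forall\alpha\in\Phi^+\}$ and $C_w=w(C_e)$. **The digraph $\Gamma_{D_n}$.** Vertices are points $(x,y)_{(u,v)}$ with $(u,v)\in\{(1,0),(4,0)\}\cup\{(2,i),(3,i):1\le i\le n-1\}$. The edges are: * Part $(1,0)$: $(x,y)\to(x,y+1)$ for $0\le x\le y$, $1\le y\le n-2$; $(x-1,y)\to(x,y)$ for $1\le x\le y\le n-2$. * Parts $(2,i)$: $(x,0)\to(x,1)$ for $i-1\le x\le n-1$; $(x-1,0)\to(x,0)$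 for $i\le x\le n-1$; $(n-1,1)\to(n-2,1)$. * Parts $(3,i)$: $(x,0)\to(x,1)$ for $0\le x\le n-1$; $(x-1,0)\to(x,0)$ for $1\le x\le n-1$; $(x-1,1)\to(x,1)$ for $1\le x\le i-1$; $(n-1,1)\to(n-2,1)$. * Part $(4,0)$: $(x,y)\to(x,y+1)$ for $x\ge0$, $n-2\le y\le 2n-5$, $x+y\le 2n-4$; $(x-1,y)\to(x,y)$ for $x\ge1$, $y\ge n-2$, $x+y\le 2n-4$; $(x,y)\to(x-1,y)$ for $x+y=2n-3$, $n-1\le y\le 2n-5$; and $(0,2n-4)\to(1,2n-4)$. * Between parts: $(i-1,n-1)_{(1,0)}\to(i-1,0)_{(2,i)}$ for $1\le i\le n-1$; $(j-1,1)_{(2,i)}\to(i-1,0)_{(3,j)}$ and $(j-1,1)_{(3,i)}\to(j-1,n-2)_{(4,0)}$ for $1\le i\le j\le n-1$. Put $I=(0,1)_{(1,0)}$ and $F=(1,2n-4)_{(4,0)}$. A *corner* is a path $(p-1,q)_{(s,t)}\to(p,q)_{(s,t)}\to(p,q+1)_{(s,t)}$. The corners associated to the positive roots are those with the following $(p,q)_{(s,t)}$: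 * $(i,j)_{(1,0)}$ for $\alpha_{ij}$, $1\le i\le j\le n-2$; * $(i,0)_{(2,t)}$, $1\le t\le i$, for $\alpha_{i,n-1}$, $1\le i\le n-1$; * $(i,0)_{(3,t)}$, $1\le t\le n-1$, for $\alpha_{i,n-2}+\alpha_n$, $1\le i\le n-1$; * $(i,2n-3-k)_{(4,0)}$ for $\alpha_{in}+\alpha_{k,n-2}$, $1\le i<k\le n-1$. **Theorem.** Let $w\in W$ and let $\Pi=\{\pi_1,\dots,\pi_m\}$ be the set of all corners associated to the roots in $N(w^{-1})$, with initial points $I_1,\dots,I_m$ and final points $F_1,\dots,F_m$. Let $\gamma(P\to Q)$ be the number of directed paths from $P$ to $Q$ in $\Gamma_{D_n}$. Then the number of regions of the Shi arrangement contained in $C_w$ is finite and equal to $$\det\begin{pmatrix}1&\gamma(F_2\to I_1)&\cdots&\gamma(F_m\to I_1)&\gamma(I\to I_1)\\ \gamma(F_1\to I_2)&1&\cdots&\gamma(F_m\to I_2)&\gamma(I\to I_2)\\ \vdots&\vdots&\ddots&\vdots&\vdots\\ \gamma(F_1\to I_m)&\gamma(F_2\to I_m)&\cdots&1&\gamma(I\to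 I_m)\\ \gamma(F_1\to F)&\gamma(F_2\to F)&\cdots&\gamma(F_m\to F)&\gamma(I\to F)\end{pmatrix}.$$ Moreover, whenever $V_1=(x_1,y_1)_{(u_1,v_1)}$ is $I$ or the final point of a corner associated to a positive root, and $V_2=(x_2,y_2)_{(u_2,v_2)}$ is $F$ or the initial point of such a corner, there are finitely many paths from $V_1$ to $V_2$ and $$\gamma(V_1\to V_2)=\begin{cases} \gamma_A((x_1,y_1)\to(x_2,y_2)) & u_1=u_2=1\\ \gamma_T((x_1,y_1)\to v_2-1) & u_1=1,\ u_2=2\\ \sum_{i=0}^{\min(x_2,v_2-1)}\gamma_T((x_1,y_1)\to i) & u_1=1,\ u_2=3,\ v_2\ne n-1\\ \sum_{i=0}^{\min(x_2,v_2-1)}2\,\gamma_T((x_1,y_1)\to i) & u_1=1,\ u_2=3,\ v_2=n-1\\ \gamma_D(V_1\to V_2) & u_1=1,\ u_2=4\\ 1 & u_1=2,\ u_2=3,\ x_2\ge v_1-1,\ v_2=\min(x_1+1,n-1)\\ (n-v_1+1)\,\gamma_B((n-2,n-2)\to(x_2,y_2)) & u_1=2,\ u_2=4,\ x_1\ge n-2\\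 (x_1-v_1+2)\,\gamma_B((x_1,n-2)\to(x_2,y_2))+2\,\gamma_B((n-2,n-2)\to(x_2,y_2))\\ \quad{}+\sum_{j=x_1+1}^{n-3}\gamma_B((j,n-2)\to(x_2,y_2)) & u_1=2,\ u_2=4,\ x_1<n-2\\ \gamma_B((v_1-1,n-2)\to(x_2,y_2)) & u_1=3,\ u_2=4,\ x_1<v_1\\ \gamma_B((x_1,n-2)\to(x_2,y_2)) & u_1=3,\ u_2=4,\ v_1\le x_1<n-1\\ \gamma_B((n-2,n-2)\to(x_2,y_2)) & u_1=3,\ u_2=4,\ x_1=n-1\\ \gamma_B((x_1,y_1)\to(x_2,y_2)) & u_1=u_2=4\\ 0 & \text{otherwise,} \end{cases}$$ so that the determinant with the entries given by this formula is also the number of regions in $C_w$. Here: * $\gamma_A((a,b)\to(c,d))=\binom{c+d-a-b}{d-b}-\binom{c+d-a-b}{d-a+1}$ if $a\le c$ and $b\le d$, and $0$ otherwise; * $\gamma_B((a,b)\to(c,d))=\gamma_A((a,b)\to(c,d))$ if $(c,d)\ne(1,2n-4)$; and $\gamma_B((a,b)\to(1,2n-4))$ is $1$ if $a+b=2n-3$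 and $\sum_{i=0}^{n-2}\gamma_A((a,b)\to(i,2n-4-i))$ otherwise; * $\gamma_T((a,b)\to k)=\gamma_A((a,b)\to(k,n-2))$ if $b\ne n-1$; and $\gamma_T((a,n-1)\to k)$ is $1$ if $a=k$ and $0$ otherwise; * $\gamma_D(V_1\to V_2)=\sum_{i=0}^{n-2}\sum_{j=1}^{i+1}\sum_{k=0}^{j-1}\mu_j\,\lambda_{i,j,k}\,\gamma_T((x_1,y_1)\to k)\,\gamma_B((i,n-2)\to(x_2,y_2))$, with $\mu_j=2$ if $j=n-1$ and $\mu_j=1$ otherwise, and with $\lambda_{i,j,k}$ equal to $j-k+1$ if $i=j-1=n-2$, to $j-k$ if $i=j-1<n-2$, to $2$ if $j-1<i=n-2$, and to $1$ if $j-1<i<n-2$. -/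

import Mathlib

open scoped RealInnerProductSpace

namespace ShiD

/-! ### The root system, the Weyl group and the Shi arrangement of type `D_n` -/

/-- Euclidean space `ℝⁿ`. -/
abbrev E (n : ℕ) := EuclideanSpace ℝ (Fin n)

/-- The standard basis vector `e_{i+1}`, for `i = 0, …, n-1`. -/
noncomputable def basisVec (n : ℕ) (i : Fin n) : E n := EuclideanSpace.single i 1

/-- The positive roots `e_i - e_j` and `e_i + e_j` with `i < j`. -/
def posRoots (n : ℕ) : Set (E n) :=
  {v | ∃ i j : Fin n, i < j ∧
    (v = basisVec n i - basisVec n j ∨ v = basisVec n i + basisVec n j)}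

/-- The negative roots. -/
def negRoots (n : ℕ) : Set (E n) := {v | -v ∈ posRoots n}

/-- The root system `Φ` of type `D_n`. -/
def roots (n : ℕ) : Set (E n) := posRoots n ∪ negRoots n

/-- The Weyl group: the group generated by the reflections `s_α` for `α ∈ Φ`. -/
noncomputable def weylGroup (n : ℕ) : Subgroup (E n ≃ₗᵢ[ℝ] E n) :=
  Subgroup.closure {s | ∃ α ∈ roots n, s = (Submodule.span ℝ {α})ᗮ.reflection}

/-- The inversion set `N(w) = Φ⁺ ∩ w(Φ⁻)`. -/
def inversionSet (n : ℕ) (w : weylGroup n) : Set (E n) :=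
  posRoots n ∩ (w : E n ≃ₗᵢ[ℝ] E n) '' negRoots n

/-- The affine hyperplane `H_{α,k} = {v | ⟨α, v⟩ = k}`. -/
def hyperplane (n : ℕ) (α : E n) (k : ℝ) : Set (E n) := {v | ⟪α, v⟫ = k}

/-- The Shi arrangement: all `H_{α,k}` with `α ∈ Φ⁺` and `k ∈ {0, 1}`. -/
def shiArrangement (n : ℕ) : Set (Set (E n)) :=
  {H | ∃ α ∈ posRoots n, ∃ k ∈ ({0, 1} : Set ℝ), H = hyperplane n α k}

/-- The regions of the Shi arrangement: the connected components of the complement of the union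
of its hyperplanes. -/
def shiRegions (n : ℕ) : Set (Set (E n)) :=
  {R | ∃ x ∈ (⋃₀ shiArrangement n)ᶜ, R = connectedComponentIn (⋃₀ shiArrangement n)ᶜ x}

/-- The dominant cone `C_e`. -/
def dominantCone (n : ℕ) : Set (E n) := {x | ∀ α ∈ posRoots n, 0 < ⟪α, x⟫}

/-- The Weyl cone `C_w = w(C_e)`. -/
def weylCone (n : ℕ) (w : weylGroup n) : Set (E n) :=
  (w : E n ≃ₗᵢ[ℝ] E n) '' dominantCone n

/-- The regions of the Shi arrangement that lie in the Weyl cone `C_w`. -/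
def regionsInCone (n : ℕ) (w : weylGroup n) : Set (Set (E n)) :=
  {R | R ∈ shiRegions n ∧ R ⊆ weylCone n w}

/-! ### Simple roots, with the indices `1, …, n` -/

/-- The vector `e_k` for `1 ≤ k ≤ n` (and `0` for all other `k`). -/
noncomputable def eVec (n k : ℕ) : E n :=
  WithLp.toLp 2 (fun i : Fin n => if (i : ℕ) + 1 = k then 1 else 0)

/-- The simple roots: `α_k = e_k - e_{k+1}` for `k ≠ n`, and `α_n = e_{n-1} + e_n`. -/
noncomputable def simpleRoot (n k : ℕ) : E n :=
  if k = n then eVec n (n - 1) + eVec n n else eVec n k - eVec n (k + 1)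

/-- `α_{ij} = α_i + α_{i+1} + ⋯ + α_j` (zero if `j < i`). -/
noncomputable def rootSum (n i j : ℕ) : E n := ∑ k ∈ Finset.Icc i j, simpleRoot n k

/-! ### The digraph `Γ_{D_n}` -/

/-- The point `(x, y)_{(u, v)}`: lattice coordinates `(x, y)` in the part with index `(u, v)`.
The parts are `(1, 0)`, `(2, v)`, `(3, v)` with `1 ≤ v ≤ n - 1`, and `(4, 0)`. -/
@[ext] structure Vertex where
  x : ℕ
  y : ℕ
  u : ℕ
  v : ℕ
deriving DecidableEq

/-- The directed edges of `Γ_{D_n}`. -/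
inductive Edge (n : ℕ) : Vertex → Vertex → Prop
  -- the bottom part: rows of 1, 2, …, n-2 boxes, without the edges on the top
  | north1 (x y : ℕ) (hx : x ≤ y) (hy : 1 ≤ y) (hyn : y ≤ n - 2) :
      Edge n ⟨x, y, 1, 0⟩ ⟨x, y + 1, 1, 0⟩
  | east1 (x y : ℕ) (hx : x + 1 ≤ y) (hy : 1 ≤ y) (hyn : y ≤ n - 2) :
      Edge n ⟨x, y, 1, 0⟩ ⟨x + 1, y, 1, 0⟩
  -- from the i-th sink of the bottom part to the i-th copy of the upper middle row
  | link12 (i : ℕ) (hi : 1 ≤ i) (hin : i ≤ n - 1) :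
      Edge n ⟨i - 1, n - 1, 1, 0⟩ ⟨i - 1, 0, 2, i⟩
  -- the i-th copy of the upper middle row
  | north2 (i x : ℕ) (hi : 1 ≤ i) (hin : i ≤ n - 1) (hx : i - 1 ≤ x) (hxn : x ≤ n - 1) :
      Edge n ⟨x, 0, 2, i⟩ ⟨x, 1, 2, i⟩
  | east2 (i x : ℕ) (hi : 1 ≤ i) (hin : i ≤ n - 1) (hx : i - 1 ≤ x) (hxn : x + 1 ≤ n - 1) :
      Edge n ⟨x, 0, 2, i⟩ ⟨x + 1, 0, 2, i⟩
  | west2 (i : ℕ) (hi : 1 ≤ i) (hin : i ≤ n - 1) :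
      Edge n ⟨n - 1, 1, 2, i⟩ ⟨n - 2, 1, 2, i⟩
  -- from the sinks of the i-th copy of the upper middle row, numbered j = i, …, n-1
  | link23 (i j : ℕ) (hi : 1 ≤ i) (hij : i ≤ j) (hjn : j ≤ n - 1) :
      Edge n ⟨j - 1, 1, 2, i⟩ ⟨i - 1, 0, 3, j⟩
  -- the i-th copy of the lower middle row
  | north3 (i x : ℕ) (hi : 1 ≤ i) (hin : i ≤ n - 1) (hxn : x ≤ n - 1) :
      Edge n ⟨x, 0, 3, i⟩ ⟨x, 1, 3, i⟩
  | east3 (i x : ℕ) (hi : 1 ≤ i) (hin : i ≤ n - 1) (hxn : x + 1 ≤ n - 1) :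
      Edge n ⟨x, 0, 3, i⟩ ⟨x + 1, 0, 3, i⟩
  | topEast3 (i x : ℕ) (hi : 1 ≤ i) (hin : i ≤ n - 1) (hx : x + 1 ≤ i - 1) :
      Edge n ⟨x, 1, 3, i⟩ ⟨x + 1, 1, 3, i⟩
  | west3 (i : ℕ) (hi : 1 ≤ i) (hin : i ≤ n - 1) :
      Edge n ⟨n - 1, 1, 3, i⟩ ⟨n - 2, 1, 3, i⟩
  -- from the sinks of the i-th copy of the lower middle row, numbered j = i, …, n-1
  | link34 (i j : ℕ) (hi : 1 ≤ i) (hij : i ≤ j) (hjn : j ≤ n - 1) :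
      Edge n ⟨j - 1, 1, 3, i⟩ ⟨j - 1, n - 2, 4, 0⟩
  -- the top part: rows of n-2, n-3, …, 1 boxes
  | north4 (x y : ℕ) (hy : n - 2 ≤ y) (hyn : y + 1 ≤ 2 * n - 4) (hxy : x + y ≤ 2 * n - 4) :
      Edge n ⟨x, y, 4, 0⟩ ⟨x, y + 1, 4, 0⟩
  | east4 (x y : ℕ) (hy : n - 2 ≤ y) (hxy : x + 1 + y ≤ 2 * n - 4) :
      Edge n ⟨x, y, 4, 0⟩ ⟨x + 1, y, 4, 0⟩
  | topEast4 :
      Edge n ⟨0, 2 * n - 4, 4, 0⟩ ⟨1, 2 * n - 4, 4, 0⟩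
  | west4 (x y : ℕ) (hy : n - 1 ≤ y) (hyn : y + 1 ≤ 2 * n - 4) (hxy : x + 1 + y = 2 * n - 3) :
      Edge n ⟨x + 1, y, 4, 0⟩ ⟨x, y, 4, 0⟩

/-- The digraph `Γ_{D_n}`. (Points of type `Vertex` that are not vertices of the diagram carry no
edges.) -/
def Gamma (n : ℕ) : Digraph Vertex where
  Adj := Edge n

/-- The source `I` of `Γ_{D_n}`. -/
def source : Vertex := ⟨0, 1, 1, 0⟩

/-- The sink `F` of `Γ_{D_n}`. -/
def sink (n : ℕ) : Vertex := ⟨1, 2 * n - 4, 4, 0⟩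

/-- The directed paths from `P` to `Q` in a digraph, as lists of vertices; the list `[P]` is the
path of length zero. -/
def paths {V : Type*} (G : Digraph V) (P Q : V) : Set (List V) :=
  {l | l.IsChain G.Adj ∧ l.head? = some P ∧ l.getLast? = some Q}

/-- The number `γ(P → Q)` of paths from `P` to `Q` in `Γ_{D_n}`. -/
noncomputable def pathCount (n : ℕ) (P Q : Vertex) : ℤ := ((paths (Gamma n) P Q).ncard : ℤ)

/-! ### Corners -/

/-- The vertex one unit to the east, in the same part. -/
def Vertex.br (P : Vertex) : Vertex := ⟨P.x + 1, P.y, P.u, P.v⟩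

/-- The vertex one unit to the east and one to the north, in the same part. -/
def Vertex.tr (P : Vertex) : Vertex := ⟨P.x + 1, P.y + 1, P.u, P.v⟩

/-- `IsCorner n α P` says that there is a box with the label `α` in `Γ_{D_n}`, with bottom left
vertex `P`, whose bottom and right edges belong to `Γ_{D_n}`. The corner of this box is the path
`P → P.br → P.tr`; it has the initial point `P` and the final point `P.tr`. A root may have several
corners. -/
inductive IsCorner (n : ℕ) : E n → Vertex → Prop
  -- the bottom part: box i of row j, with the root α_{ij}
  | part1 (i j : ℕ) (hi : 1 ≤ i) (hij : i ≤ j) (hj : j ≤ n - 2) :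
      IsCorner n (rootSum n i j) ⟨i - 1, j, 1, 0⟩
  -- box i of the t-th copy of the upper middle row, with the root α_{i,n-1}
  | part2 (t i : ℕ) (ht : 1 ≤ t) (hti : t ≤ i) (hi : i ≤ n - 1) :
      IsCorner n (rootSum n i (n - 1)) ⟨i - 1, 0, 2, t⟩
  -- box i of the t-th copy of the lower middle row, with the root α_{i,n-2} + α_n
  -- (which is α_n for i = n-1)
  | part3 (t i : ℕ) (ht : 1 ≤ t) (htn : t ≤ n - 1) (hi : 1 ≤ i) (hin : i ≤ n - 1) :
      IsCorner n (rootSum n i (n - 2) + simpleRoot n n) ⟨i - 1, 0, 3, t⟩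
  -- box i of row n-k (from below) of the top part, with the root α_{in} + α_{k,n-2}
  -- (which is α_{in} in the bottom row, k = n-1)
  | part4 (i k : ℕ) (hi : 1 ≤ i) (hik : i < k) (hk : k ≤ n - 1) :
      IsCorner n (rootSum n i n + rootSum n k (n - 2)) ⟨i - 1, 2 * n - 3 - k, 4, 0⟩

/-- A corner is a path in `Γ_{D_n}`. -/
theorem IsCorner.isPath {n : ℕ} {α : E n} {P : Vertex} (h : IsCorner n α P) :
    [P, P.br, P.tr] ∈ paths (Gamma n) P P.tr := by
  have key : Edge n P P.br ∧ Edge n P.br P.tr := by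
    cases h with
    | part1 i j hi hij hj =>
      exact ⟨Edge.east1 (i - 1) j (by omega) (by omega) hj,
        Edge.north1 (i - 1 + 1) j (by omega) (by omega) hj⟩
    | part2 t i ht hti hi =>
      exact ⟨Edge.east2 t (i - 1) ht (by omega) (by omega) (by omega),
        Edge.north2 t (i - 1 + 1) ht (by omega) (by omega) (by omega)⟩
    | part3 t i ht htn hi hin =>
      exact ⟨Edge.east3 t (i - 1) ht (by omega) (by omega),
        Edge.north3 t (i - 1 + 1) ht (by omega) (by omega)⟩
    | part4 i k hi hik hk =>
      exact ⟨Edge.east4 (i - 1) (2 * n - 3 - k) (by omega) (by omega),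
        Edge.north4 (i - 1 + 1) (2 * n - 3 - k) (by omega) (by omega) (by omega)⟩
  refine ⟨?_, by simp, by simp⟩
  simp [Gamma, key.1, key.2]

/-- The corners of the roots in `S`, given by their initial points, form a finite set. -/
theorem finite_corners (n : ℕ) (S : Set (E n)) : {P | ∃ α ∈ S, IsCorner n α P}.Finite := by
  refine Set.Finite.subset (((Finset.range (2 * n + 5) ×ˢ Finset.range (2 * n + 5) ×ˢ
    Finset.range (2 * n + 5) ×ˢ Finset.range (2 * n + 5)).finite_toSet).image
    (fun p : ℕ × ℕ × ℕ × ℕ => (⟨p.1, p.2.1, p.2.2.1, p.2.2.2⟩ : Vertex))) ?_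
  rintro P ⟨α, -, h⟩
  refine ⟨(P.x, P.y, P.u, P.v), ?_, rfl⟩
  cases h <;> simp <;> omega

/-- The set `Π` of all corners of the roots in `S`, each given by its initial point. -/
noncomputable def corners (n : ℕ) (S : Set (E n)) : Finset Vertex := (finite_corners n S).toFinset

/-! ### The matrix of a collection of corners -/

/-- For corners `π_1, …, π_m` with initial points `I_i` and final points `F_i`, the matrix of size
`m + 1` with the entries `1` at `(i, i)`, `γ(F_j → I_i)` at `(i, j)` for `i ≠ j`, and with the last
column `γ(I → I_i)`, the last row `γ(F_j → F)` and the last entry `γ(I → F)`. The last row and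
column have the index `none`. -/
def cornerMatrix (n : ℕ) (C : Finset Vertex) (γ : Vertex → Vertex → ℤ) :
    Matrix (Option {P // P ∈ C}) (Option {P // P ∈ C}) ℤ :=
  fun r c =>
    match r, c with
    | some i, some j => if i = j then 1 else γ j.1.tr i.1
    | some i, none => γ source i.1
    | none, some j => γ j.1.tr (sink n)
    | none, none => γ source (sink n)

/-! ### The explicit formula for the entries -/

/-- The number of lattice paths with north and east steps from `(a, b)` to `(c, d)` that stay weakly
above the line `x = y`. -/
def gammaA (a b c d : ℕ) : ℤ :=
  if a ≤ c ∧ b ≤ d then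
    ((c + d - a - b).choose (d - b) : ℤ) - ((c + d - a - b).choose (d + 1 - a) : ℤ)
  else 0

/-- The sum over the points `(i, 2m - i)` of the diagonal `x + y = 2m`. -/
def gammaDiag (m a b : ℕ) : ℤ :=
  if a + b = 2 * m + 1 then 1 else ∑ i ∈ Finset.range (m + 1), gammaA a b i (2 * m - i)

/-- The formula inside the top part, whose sink is `(1, 2n - 4)`. -/
def gammaB (n a b c d : ℕ) : ℤ :=
  if c = 1 ∧ d = 2 * n - 4 then gammaDiag (n - 2) a b else gammaA a b c d

/-- The formula for the paths from `(a, b)` to the top vertex `(k, n - 1)` inside the bottom part,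
where the horizontal edges at height `n - 1` are removed. -/
def gammaTop (n a b k : ℕ) : ℤ :=
  if b = n - 1 then (if a = k then 1 else 0) else gammaA a b k (n - 2)

/-- The coefficient `μ_j`. -/
def coeffMu (n j : ℕ) : ℤ := if j = n - 1 then 2 else 1

/-- The coefficient `λ_{i,j,k}`, for `k < j ≤ i + 1 ≤ n - 1`. -/
def coeffLambda (n i j k : ℕ) : ℤ :=
  if i + 1 = j then (if i = n - 2 then (j : ℤ) - k + 1 else (j : ℤ) - k)
  else if i = n - 2 then 2 else 1

/-- The formula for the paths from the bottom part to the top part. -/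
def gammaD (n a b c d : ℕ) : ℤ :=
  ∑ i ∈ Finset.range (n - 1), ∑ j ∈ Finset.Icc 1 (i + 1), ∑ k ∈ Finset.range j,
    coeffMu n j * coeffLambda n i j k * gammaTop n a b k * gammaB n i (n - 2) c d

/-- The explicit formula for `γ(P → Q)`, where `P` is `I` or the final point of a corner and `Q` is
`F` or the initial point of a corner. -/
def gammaFormula (n : ℕ) (P Q : Vertex) : ℤ :=
  if P.u = 1 ∧ Q.u = 1 then gammaA P.x P.y Q.x Q.y
  else if P.u = 1 ∧ Q.u = 2 then gammaTop n P.x P.y (Q.v - 1)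
  else if P.u = 1 ∧ Q.u = 3 ∧ Q.v ≠ n - 1 then
    ∑ i ∈ Finset.range (min Q.x (Q.v - 1) + 1), gammaTop n P.x P.y i
  else if P.u = 1 ∧ Q.u = 3 ∧ Q.v = n - 1 then
    ∑ i ∈ Finset.range (min Q.x (Q.v - 1) + 1), 2 * gammaTop n P.x P.y i
  else if P.u = 1 ∧ Q.u = 4 then gammaD n P.x P.y Q.x Q.y
  else if P.u = 2 ∧ Q.u = 3 ∧ P.v - 1 ≤ Q.x ∧ Q.v = min (P.x + 1) (n - 1) then 1
  else if P.u = 2 ∧ Q.u = 4 ∧ n - 2 ≤ P.x then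
    ((n : ℤ) - P.v + 1) * gammaB n (n - 2) (n - 2) Q.x Q.y
  else if P.u = 2 ∧ Q.u = 4 ∧ P.x < n - 2 then
    ((P.x : ℤ) - P.v + 2) * gammaB n P.x (n - 2) Q.x Q.y
      + 2 * gammaB n (n - 2) (n - 2) Q.x Q.y
      + ∑ j ∈ Finset.Icc (P.x + 1) (n - 3), gammaB n j (n - 2) Q.x Q.y
  else if P.u = 3 ∧ Q.u = 4 ∧ P.x < P.v then gammaB n (P.v - 1) (n - 2) Q.x Q.y
  else if P.u = 3 ∧ Q.u = 4 ∧ P.v ≤ P.x ∧ P.x < n - 1 then gammaB n P.x (n - 2) Q.x Q.y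
  else if P.u = 3 ∧ Q.u = 4 ∧ P.x = n - 1 then gammaB n (n - 2) (n - 2) Q.x Q.y
  else if P.u = 4 ∧ Q.u = 4 then gammaB n P.x P.y Q.x Q.y
  else 0

end ShiD

/-! Regions. Applying w⁻¹ turns the regions in C_w into the pieces into which the dominant cone is
cut by the hyperplanes ⟨t, y⟩ = 1, where t runs through the set T of positive roots outside N(w⁻¹);
all other Shi hyperplanes miss C_w. On a piece, the roots of T with value above 1 form an upper set
of T in the root order. Every upper set occurs (`exists_dominant_point`): otherwise Gordan's theorem
gives a relation between roots that `multisets_eq_zero` excludes. Upper sets correspond to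
antichains, so the regions are counted by the antichains of T (`ncard_regionsInCone`).

Antichains. Let c(P) be the number of antichains of T whose members are ahead of the vertex P
(`IsAhead`). Take a box with bottom left vertex P, label s, east neighbour U, north neighbour V and
opposite vertex D. The roots ahead of P are s and those ahead of U or V; the roots ahead of D are
those ahead of both, and they are also the ones incomparable with s; a root ahead of U only is
comparable with every root ahead of V only. Inclusion-exclusion gives c(U) + c(V) - c(D) antichains
without s, and if s is in T there are c(D) antichains with s. So c(P) = c(U) + c(V), corrected by
-c(D) exactly when s is in N(w⁻¹) (`antichainCount_diamond`). Along the remaining edges c is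
constant, and c(F) = 1.

Determinant. Hence c(P) = γ(P → F) - ∑ γ(P → I_i) c(F_i). Row operations with the coefficients
-c(F_i) reduce the last row of the corner matrix to (0, …, 0, c(I)); what remains is triangular with
ones on the diagonal, so the determinant is c(I) (`det_cornerMatrix`), and all of T is ahead of I.

The copies. The roots e_a - e_n and e_b + e_n are always incomparable, so the two middle rows are
crossed independently from the same starting column. The index i of the part (2, i) remembers that
column, the index j of (3, j) remembers where the upper middle row was left, and the top part is
entered at the larger of the two exit columns.

Entries. The path recursion has only one solution, so the explicit formula follows once the closed
expression `count` is shown to satisfy it (`pathRec_count`). -/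

namespace ShiD

/-! ### Counting paths in finite acyclic digraphs -/

section PathCount

variable {V : Type*} {G : Digraph V}

theorem mem_paths_iff {P Q : V} {l : List V} :
    l ∈ paths G P Q ↔ (P = Q ∧ l = [P]) ∨ ∃ P', G.Adj P P' ∧ ∃ l' ∈ paths G P' Q, l = P :: l' := by
  constructor
  · rintro ⟨hc, hh, hl⟩
    match l with
    | [] => simp at hh
    | [a] =>
      simp at hh hl
      subst hh
      exact Or.inl ⟨hl, rfl⟩
    | a :: b :: l =>
      simp at hh
      subst hh
      rw [List.isChain_cons_cons] at hc
      refine Or.inr ⟨b, hc.1, b :: l, ⟨hc.2, rfl, ?_⟩, rfl⟩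
      simpa using hl
  · rintro (⟨rfl, rfl⟩ | ⟨P', hP, l', ⟨hc, hh, hl⟩, rfl⟩)
    · exact ⟨by simp, rfl, rfl⟩
    · match l' with
      | [] => simp at hh
      | b :: l' =>
        simp at hh
        subst hh
        refine ⟨?_, rfl, ?_⟩
        · rw [List.isChain_cons_cons]
          exact ⟨hP, hc⟩
        · simpa using hl

theorem paths_eq [DecidableEq V] (P Q : V) (s : Finset V) (hs : ∀ P', G.Adj P P' ↔ P' ∈ s) :
    paths G P Q = (if P = Q then {[P]} else ∅) ∪ ⋃ P' ∈ s, (List.cons P) '' paths G P' Q := by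
  ext l
  rw [mem_paths_iff, Set.mem_union]
  refine or_congr ?_ ?_
  · split_ifs with h <;> simp [h]
  · simp only [Set.mem_iUnion, Set.mem_image, hs, exists_prop, eq_comm]

theorem finite_paths (r : V → ℕ) (hr : ∀ P P', G.Adj P P' → r P' < r P) (succ : V → Finset V)
    (hs : ∀ P P', G.Adj P P' ↔ P' ∈ succ P) (P Q : V) : (paths G P Q).Finite := by
  classical
  induction h : r P using Nat.strong_induction_on generalizing P with
  | _ k ih =>
    rw [paths_eq P Q (succ P) (hs P)]
    refine Set.Finite.union ?_ ?_
    · split_ifs <;> simp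
    · refine Set.Finite.biUnion (succ P).finite_toSet fun P' hP' => ?_
      exact (ih (r P') (h ▸ hr P P' ((hs P P').2 hP')) P' rfl).image _

theorem ncard_biUnion_finset {ι α : Type*} [DecidableEq ι] (s : Finset ι) (t : ι → Set α)
    (hf : ∀ i ∈ s, (t i).Finite)
    (hd : ∀ i ∈ s, ∀ j ∈ s, i ≠ j → Disjoint (t i) (t j)) :
    (⋃ i ∈ s, t i).ncard = ∑ i ∈ s, (t i).ncard := by
  induction s using Finset.induction_on with
  | empty => simp
  | insert a s ha ih =>
    have hfa := hf a (Finset.mem_insert_self a s)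
    have hfs : (⋃ i ∈ s, t i).Finite :=
      Set.Finite.biUnion s.finite_toSet fun i hi => hf i (Finset.mem_insert_of_mem hi)
    rw [Finset.set_biUnion_insert, Set.ncard_union_eq ?_ hfa hfs, Finset.sum_insert ha, ih]
    · exact fun i hi => hf i (Finset.mem_insert_of_mem hi)
    · exact fun i hi j hj => hd i (Finset.mem_insert_of_mem hi) j (Finset.mem_insert_of_mem hj)
    · rw [Set.disjoint_iUnion₂_right]
      intro i hi
      exact hd a (Finset.mem_insert_self a s) i (Finset.mem_insert_of_mem hi)
        (fun h => ha (h ▸ hi))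

theorem ncard_paths [DecidableEq V] (hfin : ∀ P Q : V, (paths G P Q).Finite) (P Q : V)
    (s : Finset V) (hs : ∀ P', G.Adj P P' ↔ P' ∈ s) :
    ((paths G P Q).ncard : ℤ)
      = (if P = Q then 1 else 0) + ∑ P' ∈ s, ((paths G P' Q).ncard : ℤ) := by
  have h1 : (if P = Q then {[P]} else ∅ : Set (List V)).Finite := by split_ifs <;> simp
  have h2 : (⋃ P' ∈ s, (List.cons P) '' paths G P' Q).Finite :=
    Set.Finite.biUnion s.finite_toSet fun i _ => (hfin i Q).image _
  rw [paths_eq P Q s hs, Set.ncard_union_eq ?_ h1 h2, ncard_biUnion_finset]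
  · push_cast
    congr 1
    · split_ifs <;> simp
    · refine Finset.sum_congr rfl fun P' _ => ?_
      rw [Set.ncard_image_of_injective _ (List.cons_injective)]
  · exact fun i _ => (hfin i Q).image _
  · intro i _ j _ hij
    rw [Set.disjoint_left]
    rintro _ ⟨l, hl, rfl⟩ ⟨l', hl', h⟩
    have : l' = l := by simpa using h
    subst this
    exact hij (Option.some_injective _ (hl.2.1.symm.trans hl'.2.1))
  · rw [Set.disjoint_left]
    intro l hl hl'
    split_ifs at hl
    · simp only [Set.mem_singleton_iff] at hl
      subst hl
      simp only [Set.mem_iUnion, Set.mem_image] at hl'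
      obtain ⟨P', _, l', hl', h⟩ := hl'
      have : l' = [] := by simpa using h
      subst this
      simpa using hl'.2.1
    · exact hl

theorem ncard_paths_eq_zero (r : V → ℕ) (hr : ∀ P P', G.Adj P P' → r P' < r P) {P Q : V}
    (h : r P < r Q) : (paths G P Q).ncard = 0 := by
  have : paths G P Q = ∅ := by
    rw [Set.eq_empty_iff_forall_notMem]
    intro l
    induction l generalizing P with
    | nil => rintro ⟨_, h, _⟩; simp at h
    | cons a l ih =>
      rw [mem_paths_iff]
      rintro (⟨rfl, -⟩ | ⟨P', hP, l', hl', h'⟩)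
      · exact lt_irrefl _ h
      · obtain ⟨rfl, rfl⟩ := List.cons.inj h'
        exact ih ((hr _ _ hP).trans h) hl'
  simp [this]

/-- A function that satisfies the inhomogeneous path recursion is determined by its source term. -/
theorem eq_sum_ncard_paths [DecidableEq V] (r : V → ℕ) (hr : ∀ P P', G.Adj P P' → r P' < r P)
    (succ : V → Finset V) (hs : ∀ P P', G.Adj P P' ↔ P' ∈ succ P) (S : Set V)
    (hS : ∀ P ∈ S, ∀ P', G.Adj P P' → P' ∈ S) (f g : V → ℤ) (Z : Finset V)
    (hf : ∀ P ∈ S, f P = g P + ∑ P' ∈ succ P, f P') (hg : ∀ P ∈ S, P ∉ Z → g P = 0)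
    (P : V) (hP : P ∈ S) : f P = ∑ Q ∈ Z, ((paths G P Q).ncard : ℤ) * g Q := by
  have hfin := finite_paths r hr succ hs
  induction h : r P using Nat.strong_induction_on generalizing P with
  | _ k ih =>
    -- Splitting off the first step of each path turns the right-hand side into g P plus the same
    -- sums at the successors, where induction on r applies.
    have h1 : ∀ Q, ((paths G P Q).ncard : ℤ) * g Q = (if P = Q then g Q else 0) +
        ∑ P' ∈ succ P, ((paths G P' Q).ncard : ℤ) * g Q := by
      intro Q
      rw [ncard_paths hfin P Q (succ P) (hs P), add_mul, Finset.sum_mul]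
      congr 1
      split_ifs <;> simp
    rw [hf P hP, Finset.sum_congr rfl fun Q _ => h1 Q, Finset.sum_add_distrib, Finset.sum_comm]
    congr 1
    · rw [Finset.sum_ite_eq]
      split_ifs with hz
      · rfl
      · exact hg P hP hz
    · refine Finset.sum_congr rfl fun P' hP' => ?_
      have ha := (hs P P').2 hP'
      exact ih (r P') (h ▸ hr P P' ha) P' (hS P hP P' ha) rfl

end PathCount

/-! ### The determinant of a corner matrix -/

/-- Grouping the indices by b makes the matrix block triangular. Inside a fibre of b the strict
inequality kills all off-diagonal entries, so each block is diagonal; b need not be injective. -/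
theorem det_eq_prod_diag {m R β : Type*} [Fintype m] [DecidableEq m] [CommRing R] [LinearOrder β]
    (M : Matrix m m R) (b : m → β) (h : ∀ i j, i ≠ j → M i j ≠ 0 → b i < b j) :
    M.det = ∏ i, M i i := by
  have hb : M.BlockTriangular b := by
    intro i j hij
    by_contra hne
    exact lt_asymm hij (h i j (fun e => by subst e; exact lt_irrefl _ hij) hne)
  rw [hb.det]
  rw [← Finset.prod_fiberwise_of_maps_to (g := b) (t := Finset.univ.image b)
    (fun i hi => Finset.mem_image_of_mem b hi)]
  refine Finset.prod_congr rfl fun a _ => ?_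
  have hd : M.toSquareBlock b a = Matrix.diagonal fun i : {i // b i = a} => M i i := by
    ext i j
    by_cases hij : i = j
    · subst hij
      simp [Matrix.toSquareBlock_def]
    · rw [Matrix.diagonal_apply_ne _ hij, Matrix.toSquareBlock_def, Matrix.of_apply]
      by_contra hne
      have := h i j (fun e => hij (Subtype.ext e)) hne
      rw [i.2, j.2] at this
      exact lt_irrefl _ this
  rw [hd, Matrix.det_diagonal]
  exact (Finset.prod_subtype _ (by simp) (fun i => M i i)).symm

/-- A solution of the path recursion in which every corner of `C` contributes with the opposite
sign computes the determinant of the corner matrix. -/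
theorem det_cornerMatrix (n : ℕ) (r : Vertex → ℕ) (C : Finset Vertex) (γ : Vertex → Vertex → ℤ)
    (hC : ∀ P ∈ C, r P.tr < r P) (hγ : ∀ P Q, r P < r Q → γ P Q = 0) (c : Vertex → ℤ)
    (hc : ∀ P, P = source ∨ (∃ Q ∈ C, P = Q.tr) →
      c P = γ P (sink n) - ∑ Q ∈ C, γ P Q * c Q.tr) :
    (cornerMatrix n C γ).det = c source := by
  classical
  set M := cornerMatrix n C γ with hM
  -- The last row keeps the coefficient 1, so the determinant is unchanged; -c(F_i) times row i is
  -- added to it.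
  let v : Option {P // P ∈ C} → ℤ := fun i => i.elim 1 fun P => -c P.1.tr
  let M' := M.updateRow none (∑ k, v k • M k)
  have h1 : M'.det = M.det := by
    rw [Matrix.det_updateRow_sum]
    simp [v]
  -- Since γ(F_i → I_i) = 0, the diagonal entry 1 is a Kronecker delta added to γ, just as in the
  -- off-diagonal entries.
  have hself : ∀ P ∈ C, γ P.tr P = 0 := fun P hP => hγ _ _ (hC P hP)
  have hrow : ∀ j, M' none j = if j = none then c source else 0 := by
    intro j
    have : M' none j = M none j - ∑ i : {P // P ∈ C}, M (some i) j * c i.1.tr := by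
      simp only [M', Matrix.updateRow_self, Finset.sum_apply, Pi.smul_apply, smul_eq_mul]
      rw [Fintype.sum_option]
      simp [v, sub_eq_add_neg, mul_comm]
    rw [this]
    cases j with
    | none =>
      simp only [hM, cornerMatrix, if_true]
      rw [hc source (Or.inl rfl), ← Finset.sum_coe_sort C (fun Q => γ source Q * c Q.tr)]
    | some j =>
      have h2 : ∀ i : {P // P ∈ C}, M (some i) (some j) * c i.1.tr
          = (if i = j then c i.1.tr else 0) + γ j.1.tr i.1 * c i.1.tr := by
        intro i
        simp only [hM, cornerMatrix]
        split_ifs with hij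
        · subst hij
          rw [hself i.1 i.2]
          ring
        · ring
      rw [Finset.sum_congr rfl fun i _ => h2 i, Finset.sum_add_distrib, Finset.sum_ite_eq']
      simp only [Finset.mem_univ, if_true, reduceCtorEq, if_false]
      rw [hc j.1.tr (Or.inr ⟨j.1, j.2, rfl⟩),
        Finset.sum_coe_sort C (fun Q => γ j.1.tr Q * c Q.tr)]
      simp [hM, cornerMatrix]
  have hsome : ∀ i j, M' (some i) j = M (some i) j := by
    intro i j
    simp [M', Matrix.updateRow_ne]
  -- A nonzero entry γ(F_j → I_i) forces r(I_i) ≤ r(F_j) < r(I_j), so r orders the corners; the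
  -- reduced last row comes on top.
  rw [← h1, det_eq_prod_diag M' (fun i => i.elim (⊤ : WithTop ℕ) fun P => (r P.1 : WithTop ℕ)),
    Fintype.prod_option, hrow]
  · simp [hsome, hM, cornerMatrix]
  · intro i j hij hne
    cases i with
    | none =>
      rw [hrow, if_neg (Ne.symm hij)] at hne
      exact absurd rfl hne
    | some i =>
      cases j with
      | none => exact WithTop.coe_lt_top _
      | some j =>
        have hij' : i ≠ j := fun e => hij (by rw [e])
        rw [hsome] at hne
        simp only [hM, cornerMatrix, if_neg hij'] at hne
        have : r i.1 ≤ r j.1.tr := by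
          by_contra hlt
          exact hne (hγ _ _ (not_le.1 hlt))
        simpa using this.trans_lt (hC j.1 j.2)

/-! ### The path recursion in `Γ_{D_n}` -/

/-- A quantity that strictly increases along the edges of `Γ_{D_n}`. -/
def progress (n : ℕ) (P : Vertex) : ℕ :=
  -- The multiples of n only keep the stages in order. At height 1 of a middle row the vertex with x
  -- = n - 1 precedes the others, because its edge goes west. From the antidiagonal of the top part
  -- on, paths alternate between north and west, so y - x replaces x + y.
  if P.u = 1 then P.x + P.y
  else if P.u = 2 then 10 * n + (if P.y = 0 then P.x else if P.x = n - 1 then 2 * n else 2 * n + 1)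
  else if P.u = 3 then
    20 * n + (if P.y = 0 then P.x else if P.x = n - 1 then 2 * n else 2 * n + P.x)
  else
    40 * n + (if P.x = 1 ∧ P.y = 2 * n - 4 then 20 * n
      else if 2 * n - 4 ≤ P.x + P.y then 10 * n + P.y - P.x else P.x + P.y)

/-- A quantity that strictly decreases along the edges of `Γ_{D_n}`. -/
def remaining (n : ℕ) (P : Vertex) : ℕ := 100 * n - progress n P

theorem Edge.remaining_lt {n : ℕ} (hn : 3 ≤ n) {P Q : Vertex} (h : Edge n P Q) :
    remaining n Q < remaining n P := by
  -- The upper bound is needed because `remaining` is a truncated subtraction.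
  suffices progress n P < progress n Q ∧ progress n Q ≤ 100 * n by
    unfold remaining
    omega
  cases h <;> simp [progress] <;> (try split_ifs) <;> omega

theorem finite_successors (n : ℕ) (hn : 3 ≤ n) (P : Vertex) : {Q | Edge n P Q}.Finite := by
  refine Set.Finite.subset (((Finset.range (2 * n + 5) ×ˢ Finset.range (2 * n + 5) ×ˢ
    Finset.range (2 * n + 5) ×ˢ Finset.range (2 * n + 5)).finite_toSet).image
    (fun p : ℕ × ℕ × ℕ × ℕ => (⟨p.1, p.2.1, p.2.2.1, p.2.2.2⟩ : Vertex))) ?_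
  rintro Q h
  refine ⟨(Q.x, Q.y, Q.u, Q.v), ?_, rfl⟩
  cases h <;> simp <;> omega

/-- The end points of the edges that start at `P`. -/
noncomputable def successors (n : ℕ) (hn : 3 ≤ n) (P : Vertex) : Finset Vertex :=
  (finite_successors n hn P).toFinset

theorem mem_successors {n : ℕ} {hn : 3 ≤ n} {P Q : Vertex} :
    Q ∈ successors n hn P ↔ Edge n P Q := by
  simp [successors]

theorem finite_paths_Gamma (n : ℕ) (hn : 3 ≤ n) (P Q : Vertex) : (paths (Gamma n) P Q).Finite :=
  finite_paths (remaining n) (fun _ _ h => Edge.remaining_lt hn h) (successors n hn)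
    (fun _ _ => mem_successors.symm) P Q

theorem pathCount_eq_zero {n : ℕ} (hn : 3 ≤ n) {P Q : Vertex} (h : remaining n P < remaining n Q) :
    pathCount n P Q = 0 := by
  unfold pathCount
  rw [ncard_paths_eq_zero (G := Gamma n) (remaining n) (fun _ _ h => Edge.remaining_lt hn h) h]
  rfl

theorem IsCorner.remaining_tr_lt {n : ℕ} (hn : 3 ≤ n) {α : E n} {P : Vertex} (h : IsCorner n α P) :
    remaining n P.tr < remaining n P := by
  have h1 := h.isPath.1
  simp only [List.isChain_cons_cons, List.isChain_singleton, and_true] at h1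
  exact (Edge.remaining_lt hn h1.2).trans (Edge.remaining_lt hn h1.1)

/-- The vertices of `Γ_{D_n}`, possibly with some further points in the part `(3, v)`. -/
def IsVertex (n : ℕ) (P : Vertex) : Prop :=
  (P.u = 1 ∧ P.v = 0 ∧ P.x ≤ P.y ∧ 1 ≤ P.y ∧ P.y ≤ n - 1 ∧ P.x ≤ n - 2) ∨
  (P.u = 2 ∧ 1 ≤ P.v ∧ P.v ≤ n - 1 ∧ P.y ≤ 1 ∧ P.v ≤ P.x + 1 ∧ P.x ≤ n - 1) ∨
  (P.u = 3 ∧ 1 ≤ P.v ∧ P.v ≤ n - 1 ∧ P.y ≤ 1 ∧ P.x ≤ n - 1) ∨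
  (P.u = 4 ∧ P.v = 0 ∧ n - 2 ≤ P.y ∧ P.y ≤ 2 * n - 4 ∧ P.x + P.y ≤ 2 * n - 3 ∧ P.x ≤ n - 2)

/-- `Vertex` contains points outside the diagram; closure under edges allows recursions to be stated
on the genuine vertices only. -/
theorem Edge.isVertex {n : ℕ} (hn : 3 ≤ n) {P Q : Vertex} (h : Edge n P Q) : IsVertex n Q := by
  cases h <;> simp [IsVertex] <;> omega

/-- The recursion `f P = g P + ∑ f P'`, where `P'` runs through the successors of `P`. -/
structure PathRec (n : ℕ) (f g : Vertex → ℤ) : Prop where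
  box1 : ∀ x y, x < y → y ≤ n - 2 →
    f ⟨x, y, 1, 0⟩ = g ⟨x, y, 1, 0⟩ + (f ⟨x + 1, y, 1, 0⟩ + f ⟨x, y + 1, 1, 0⟩)
  diag1 : ∀ x, 1 ≤ x → x ≤ n - 2 → f ⟨x, x, 1, 0⟩ = g ⟨x, x, 1, 0⟩ + f ⟨x, x + 1, 1, 0⟩
  top1 : ∀ x, x ≤ n - 2 → f ⟨x, n - 1, 1, 0⟩ = g ⟨x, n - 1, 1, 0⟩ + f ⟨x, 0, 2, x + 1⟩
  box2 : ∀ x v, 1 ≤ v → v ≤ x + 1 → x + 1 ≤ n - 1 →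
    f ⟨x, 0, 2, v⟩ = g ⟨x, 0, 2, v⟩ + (f ⟨x + 1, 0, 2, v⟩ + f ⟨x, 1, 2, v⟩)
  end2 : ∀ v, 1 ≤ v → v ≤ n - 1 → f ⟨n - 1, 0, 2, v⟩ = g ⟨n - 1, 0, 2, v⟩ + f ⟨n - 1, 1, 2, v⟩
  top2 : ∀ x v, 1 ≤ v → v ≤ x + 1 → x + 1 ≤ n - 1 →
    f ⟨x, 1, 2, v⟩ = g ⟨x, 1, 2, v⟩ + f ⟨v - 1, 0, 3, x + 1⟩
  back2 : ∀ v, 1 ≤ v → v ≤ n - 1 → f ⟨n - 1, 1, 2, v⟩ = g ⟨n - 1, 1, 2, v⟩ + f ⟨n - 2, 1, 2, v⟩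
  box3 : ∀ x v, 1 ≤ v → v ≤ n - 1 → x + 1 ≤ n - 1 →
    f ⟨x, 0, 3, v⟩ = g ⟨x, 0, 3, v⟩ + (f ⟨x + 1, 0, 3, v⟩ + f ⟨x, 1, 3, v⟩)
  end3 : ∀ v, 1 ≤ v → v ≤ n - 1 → f ⟨n - 1, 0, 3, v⟩ = g ⟨n - 1, 0, 3, v⟩ + f ⟨n - 1, 1, 3, v⟩
  east3 : ∀ x v, v ≤ n - 1 → x + 2 ≤ v →
    f ⟨x, 1, 3, v⟩ = g ⟨x, 1, 3, v⟩ + f ⟨x + 1, 1, 3, v⟩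
  top3 : ∀ x v, 1 ≤ v → v ≤ x + 1 → x + 1 ≤ n - 1 →
    f ⟨x, 1, 3, v⟩ = g ⟨x, 1, 3, v⟩ + f ⟨x, n - 2, 4, 0⟩
  back3 : ∀ v, 1 ≤ v → v ≤ n - 1 → f ⟨n - 1, 1, 3, v⟩ = g ⟨n - 1, 1, 3, v⟩ + f ⟨n - 2, 1, 3, v⟩
  box4 : ∀ x y, n - 2 ≤ y → x + 1 + y ≤ 2 * n - 4 →
    f ⟨x, y, 4, 0⟩ = g ⟨x, y, 4, 0⟩ + (f ⟨x + 1, y, 4, 0⟩ + f ⟨x, y + 1, 4, 0⟩)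
  diag4 : ∀ x y, n - 2 ≤ y → y + 1 ≤ 2 * n - 4 → x + y = 2 * n - 4 →
    f ⟨x, y, 4, 0⟩ = g ⟨x, y, 4, 0⟩ + f ⟨x, y + 1, 4, 0⟩
  back4 : ∀ x y, n - 1 ≤ y → y + 1 ≤ 2 * n - 4 → x + 1 + y = 2 * n - 3 →
    f ⟨x + 1, y, 4, 0⟩ = g ⟨x + 1, y, 4, 0⟩ + f ⟨x, y, 4, 0⟩
  top4 : f ⟨0, 2 * n - 4, 4, 0⟩ = g ⟨0, 2 * n - 4, 4, 0⟩ + f ⟨1, 2 * n - 4, 4, 0⟩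
  sink4 : f ⟨1, 2 * n - 4, 4, 0⟩ = g ⟨1, 2 * n - 4, 4, 0⟩

section

variable {n : ℕ} (hn : 3 ≤ n) {P : Vertex} (f g : Vertex → ℤ)

theorem rec_of_pair (Q R : Vertex) (hQR : Q ≠ R) (h1 : Edge n P Q) (h2 : Edge n P R)
    (h3 : ∀ S, Edge n P S → S = Q ∨ S = R) (h : f P = g P + (f Q + f R)) :
    f P = g P + ∑ P' ∈ successors n hn P, f P' := by
  have : successors n hn P = {Q, R} := by
    ext S
    simp only [mem_successors, Finset.mem_insert, Finset.mem_singleton]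
    refine ⟨h3 S, ?_⟩
    rintro (rfl | rfl)
    exacts [h1, h2]
  rw [this, Finset.sum_pair hQR, h]

theorem rec_of_single (Q : Vertex) (h1 : Edge n P Q)
    (h3 : ∀ S, Edge n P S → S = Q) (h : f P = g P + f Q) :
    f P = g P + ∑ P' ∈ successors n hn P, f P' := by
  have : successors n hn P = {Q} := by
    ext S
    simp only [mem_successors, Finset.mem_singleton]
    refine ⟨h3 S, ?_⟩
    rintro rfl
    exact h1
  rw [this, Finset.sum_singleton, h]

end

/-- The fields of `PathRec` exhaust the local shapes of the diagram: every vertex has at most two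
outgoing edges. -/
theorem PathRec.eq_add_sum {n : ℕ} (hn : 3 ≤ n) {f g : Vertex → ℤ} (h : PathRec n f g) {P : Vertex}
    (hP : IsVertex n P) : f P = g P + ∑ P' ∈ successors n hn P, f P' := by
  obtain ⟨x, y, u, v⟩ := P
  simp only [IsVertex] at hP
  rcases hP with ⟨rfl, rfl, h1, h2, h3, h4⟩ | ⟨rfl, h1, h2, h3, h4, h5⟩ | ⟨rfl, h1, h2, h3, h4⟩ |
    ⟨rfl, rfl, h1, h2, h3, h4⟩
  · by_cases hy : y = n - 1
    · subst hy
      refine rec_of_single hn f g ⟨x, 0, 2, x + 1⟩ (Edge.link12 (x + 1) (by omega) (by omega)) ?_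
        (h.top1 x h4)
      intro S hS
      generalize hP : Vertex.mk _ _ _ _ = P at hS
      cases hS <;> simp only [Vertex.mk.injEq] at hP <;> simp <;> omega
    · by_cases hxy : x = y
      · subst hxy
        refine rec_of_single hn f g ⟨x, x + 1, 1, 0⟩
          (Edge.north1 x x (by omega) (by omega) (by omega)) ?_ (h.diag1 x h2 (by omega))
        intro S hS
        generalize hP : Vertex.mk _ _ _ _ = P at hS
        cases hS <;> simp only [Vertex.mk.injEq] at hP <;> simp <;> omega
      · refine rec_of_pair hn f g ⟨x + 1, y, 1, 0⟩ ⟨x, y + 1, 1, 0⟩ (by simp)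
          (Edge.east1 x y (by omega) (by omega) (by omega))
          (Edge.north1 x y (by omega) (by omega) (by omega)) ?_
          (h.box1 x y (by omega) (by omega))
        intro S hS
        generalize hP : Vertex.mk _ _ _ _ = P at hS
        cases hS <;> simp only [Vertex.mk.injEq] at hP <;> simp <;> omega
  · obtain rfl | rfl : y = 0 ∨ y = 1 := by omega
    · by_cases hx : x = n - 1
      · subst hx
        refine rec_of_single hn f g ⟨n - 1, 1, 2, v⟩
          (Edge.north2 v (n - 1) (by omega) (by omega) (by omega) (by omega)) ?_ (h.end2 v h1 h2)
        intro S hS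
        generalize hP : Vertex.mk _ _ _ _ = P at hS
        cases hS <;> simp only [Vertex.mk.injEq] at hP <;> simp <;> omega
      · refine rec_of_pair hn f g ⟨x + 1, 0, 2, v⟩ ⟨x, 1, 2, v⟩ (by simp)
          (Edge.east2 v x (by omega) (by omega) (by omega) (by omega))
          (Edge.north2 v x (by omega) (by omega) (by omega) (by omega)) ?_
          (h.box2 x v (by omega) (by omega) (by omega))
        intro S hS
        generalize hP : Vertex.mk _ _ _ _ = P at hS
        cases hS <;> simp only [Vertex.mk.injEq] at hP <;> simp <;> omega
    · by_cases hx : x = n - 1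
      · subst hx
        refine rec_of_single hn f g ⟨n - 2, 1, 2, v⟩ (Edge.west2 v h1 h2) ?_ (h.back2 v h1 h2)
        intro S hS
        generalize hP : Vertex.mk _ _ _ _ = P at hS
        cases hS <;> simp only [Vertex.mk.injEq] at hP <;> simp <;> omega
      · refine rec_of_single hn f g ⟨v - 1, 0, 3, x + 1⟩
          (Edge.link23 v (x + 1) (by omega) (by omega) (by omega)) ?_
          (h.top2 x v (by omega) (by omega) (by omega))
        intro S hS
        generalize hP : Vertex.mk _ _ _ _ = P at hS
        cases hS <;> simp only [Vertex.mk.injEq] at hP <;> simp <;> omega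
  · obtain rfl | rfl : y = 0 ∨ y = 1 := by omega
    · by_cases hx : x = n - 1
      · subst hx
        refine rec_of_single hn f g ⟨n - 1, 1, 3, v⟩
          (Edge.north3 v (n - 1) (by omega) (by omega) (by omega)) ?_ (h.end3 v h1 h2)
        intro S hS
        generalize hP : Vertex.mk _ _ _ _ = P at hS
        cases hS <;> simp only [Vertex.mk.injEq] at hP <;> simp <;> omega
      · refine rec_of_pair hn f g ⟨x + 1, 0, 3, v⟩ ⟨x, 1, 3, v⟩ (by simp)
          (Edge.east3 v x (by omega) (by omega) (by omega))
          (Edge.north3 v x (by omega) (by omega) (by omega)) ?_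
          (h.box3 x v (by omega) (by omega) (by omega))
        intro S hS
        generalize hP : Vertex.mk _ _ _ _ = P at hS
        cases hS <;> simp only [Vertex.mk.injEq] at hP <;> simp <;> omega
    · by_cases hx : x = n - 1
      · subst hx
        refine rec_of_single hn f g ⟨n - 2, 1, 3, v⟩ (Edge.west3 v h1 h2) ?_ (h.back3 v h1 h2)
        intro S hS
        generalize hP : Vertex.mk _ _ _ _ = P at hS
        cases hS <;> simp only [Vertex.mk.injEq] at hP <;> simp <;> omega
      · by_cases hv : x + 2 ≤ v
        · refine rec_of_single hn f g ⟨x + 1, 1, 3, v⟩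
            (Edge.topEast3 v x (by omega) (by omega) (by omega)) ?_
            (h.east3 x v (by omega) (by omega))
          intro S hS
          generalize hP : Vertex.mk _ _ _ _ = P at hS
          cases hS <;> simp only [Vertex.mk.injEq] at hP <;> simp <;> omega
        · refine rec_of_single hn f g ⟨x, n - 2, 4, 0⟩
            (Edge.link34 v (x + 1) (by omega) (by omega) (by omega)) ?_
            (h.top3 x v (by omega) (by omega) (by omega))
          intro S hS
          generalize hP : Vertex.mk _ _ _ _ = P at hS
          cases hS <;> simp only [Vertex.mk.injEq] at hP <;> simp <;> omega
  · by_cases hy : y = 2 * n - 4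
    · subst hy
      obtain rfl | rfl : x = 0 ∨ x = 1 := by omega
      · refine rec_of_single hn f g ⟨1, 2 * n - 4, 4, 0⟩ Edge.topEast4 ?_ h.top4
        intro S hS
        generalize hP : Vertex.mk _ _ _ _ = P at hS
        cases hS <;> simp only [Vertex.mk.injEq] at hP <;> simp <;> omega
      · have : successors n hn ⟨1, 2 * n - 4, 4, 0⟩ = ∅ := by
          ext S
          simp only [mem_successors, Finset.notMem_empty, iff_false]
          intro hS
          generalize hP : Vertex.mk _ _ _ _ = P at hS
          cases hS <;> simp only [Vertex.mk.injEq] at hP <;> omega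
        rw [this, h.sink4]
        simp
    · by_cases h5 : x + y = 2 * n - 3
      · obtain ⟨x, rfl⟩ : ∃ z, x = z + 1 := ⟨x - 1, by omega⟩
        refine rec_of_single hn f g ⟨x, y, 4, 0⟩ (Edge.west4 x y (by omega) (by omega) (by omega))
          ?_ (h.back4 x y (by omega) (by omega) (by omega))
        intro S hS
        generalize hP : Vertex.mk _ _ _ _ = P at hS
        cases hS <;> simp only [Vertex.mk.injEq] at hP <;> simp <;> omega
      · by_cases h6 : x + y = 2 * n - 4
        · refine rec_of_single hn f g ⟨x, y + 1, 4, 0⟩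
            (Edge.north4 x y (by omega) (by omega) (by omega)) ?_
            (h.diag4 x y (by omega) (by omega) (by omega))
          intro S hS
          generalize hP : Vertex.mk _ _ _ _ = P at hS
          cases hS <;> simp only [Vertex.mk.injEq] at hP <;> simp <;> omega
        · refine rec_of_pair hn f g ⟨x + 1, y, 4, 0⟩ ⟨x, y + 1, 4, 0⟩ (by simp)
            (Edge.east4 x y (by omega) (by omega))
            (Edge.north4 x y (by omega) (by omega) (by omega)) ?_
            (h.box4 x y (by omega) (by omega))
          intro S hS
          generalize hP : Vertex.mk _ _ _ _ = P at hS
          cases hS <;> simp only [Vertex.mk.injEq] at hP <;> simp <;> omega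

/-- Used with Z = {Q} for the explicit path counts, and with Z consisting of F and the corners for
the antichain numbers. -/
theorem PathRec.eq_sum {n : ℕ} (hn : 3 ≤ n) {f g : Vertex → ℤ} (h : PathRec n f g) (Z : Finset Vertex)
    (hg : ∀ P, P ∉ Z → g P = 0) {P : Vertex} (hP : IsVertex n P) :
    f P = ∑ Q ∈ Z, pathCount n P Q * g Q :=
  eq_sum_ncard_paths (G := Gamma n) (remaining n) (fun _ _ h => Edge.remaining_lt hn h)
    (successors n hn) (fun _ _ => mem_successors.symm) {P | IsVertex n P}
    (fun _ _ _ h => Edge.isVertex hn h) f g Z (fun _ hP => h.eq_add_sum hn hP)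
    (fun P _ hP => hg P hP) P hP

/-! ### The explicit path counts -/

theorem gammaA_eq_zero {a b c d : ℕ} (h : ¬(a ≤ c ∧ b ≤ d)) : gammaA a b c d = 0 := if_neg h

/-- Pascal's rule, applied to both binomial coefficients of the ballot number. -/
theorem gammaA_rec {x y c d : ℕ} (hxy : x ≤ y) (hcd : c ≤ d) :
    gammaA x y c d
      = (if x = c ∧ y = d then 1 else 0) + (gammaA (x + 1) y c d + gammaA x (y + 1) c d) := by
  by_cases hx : c < x
  · simp (disch := omega) only [gammaA, if_neg]
    rfl
  by_cases hy : d < y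
  · simp (disch := omega) only [gammaA, if_neg]
    rfl
  -- Writing y = x + r, c = x + p, d = y + q removes the truncated subtractions. If p = 0 or q = 0,
  -- a neighbour overshoots the target, so these cases are treated apart.
  obtain ⟨r, rfl⟩ := Nat.exists_eq_add_of_le hxy
  obtain ⟨p, rfl⟩ := Nat.exists_eq_add_of_le (not_lt.1 hx)
  obtain ⟨q, rfl⟩ := Nat.exists_eq_add_of_le (not_lt.1 hy)
  have e1 : x + p + (x + r + q) - x - (x + r) = p + q := by omega
  have e2 : x + p + (x + r + q) - (x + 1) - (x + r) = p + q - 1 := by omega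
  have e3 : x + p + (x + r + q) - x - (x + r + 1) = p + q - 1 := by omega
  have e4 : x + r + q - (x + r) = q := by omega
  have e5 : x + r + q + 1 - x = r + q + 1 := by omega
  have e6 : x + r + q + 1 - (x + 1) = r + q := by omega
  have e7 : x + r + q - (x + r + 1) = q - 1 := by omega
  simp only [gammaA, e1, e2, e3, e4, e5, e6, e7]
  rcases p with _ | p <;> rcases q with _ | q
  · simp
  · rw [Nat.choose_eq_zero_of_lt (show 0 + (q + 1) < r + (q + 1) + 1 by omega),
      Nat.choose_eq_zero_of_lt (show 0 + (q + 1) - 1 < r + (q + 1) + 1 by omega)]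
    simp
  · rw [Nat.choose_eq_zero_of_lt (show p + 1 + 0 < r + 0 + 1 by omega),
      Nat.choose_eq_zero_of_lt (show p + 1 + 0 - 1 < r + 0 by omega)]
    simp
  · have e8 : p + 1 + (q + 1) = (p + q + 1) + 1 := by ring
    have e9 : r + (q + 1) = r + q + 1 := by ring
    simp only [e8, e9, Nat.add_sub_cancel, Nat.choose_succ_succ (p + q + 1)]
    rw [if_pos (by omega), if_neg (by omega), if_pos (by omega), if_pos (by omega)]
    push_cast
    ring

/-- The line x = y + 1 is the axis of the reflection behind the ballot formula, so the two binomial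
coefficients agree there. -/
theorem gammaA_below (y c d : ℕ) : gammaA (y + 1) y c d = 0 := by
  unfold gammaA
  split_ifs
  · rw [show d + 1 - (y + 1) = d - y by omega, sub_self]
  · rfl

theorem gammaA_diag {x c d : ℕ} (hcd : c ≤ d) :
    gammaA x x c d = (if x = c ∧ x = d then 1 else 0) + gammaA x (x + 1) c d := by
  rw [gammaA_rec le_rfl hcd, gammaA_below, zero_add]

theorem gammaTop_rec {n x y k : ℕ} (hn : 3 ≤ n) (hxy : x ≤ y) (hy : y ≤ n - 2) (hk : k ≤ n - 2) :
    gammaTop n x y k = gammaTop n (x + 1) y k + gammaTop n x (y + 1) k := by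
  unfold gammaTop
  have hne : y ≠ n - 1 := by omega
  simp only [if_neg hne, gammaA_rec hxy hk]
  -- At height n - 2 the source term of `gammaA` at (k, n - 2) becomes the final north step to (k, n
  -- - 1).
  by_cases h : y = n - 2
  · subst h
    rw [if_pos (show n - 2 + 1 = n - 1 by omega),
      gammaA_eq_zero (a := x) (b := n - 2 + 1) (by omega)]
    simp only [and_true]
    ring
  · rw [if_neg (by omega), if_neg (by omega)]
    ring

theorem gammaTop_diag {n x k : ℕ} (hn : 3 ≤ n) (hx : x ≤ n - 2) (hk : k ≤ n - 2) :
    gammaTop n x x k = gammaTop n x (x + 1) k := by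
  rw [gammaTop_rec hn le_rfl hx hk]
  unfold gammaTop
  rw [if_neg (by omega), gammaA_below, zero_add]

/-- With m = n - 2, a path to F is determined up to its first point on the antidiagonal x + y = 2m,
since the staircase from there to F is forced. Before the antidiagonal each summand obeys the
recursion of ballot numbers. -/
theorem gammaDiag_rec {m a b : ℕ} (hb : m ≤ b) (h : a + 1 + b ≤ 2 * m) :
    gammaDiag m a b = gammaDiag m (a + 1) b + gammaDiag m a (b + 1) := by
  unfold gammaDiag
  rw [if_neg (by omega), if_neg (by omega), if_neg (by omega), ← Finset.sum_add_distrib]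
  refine Finset.sum_congr rfl fun i hi => ?_
  rw [Finset.mem_range] at hi
  rw [gammaA_rec (by omega) (by omega), if_neg (by omega), zero_add]

theorem gammaDiag_eq_one {m a b : ℕ} (ha : a ≤ m) (h : a + b = 2 * m) : gammaDiag m a b = 1 := by
  unfold gammaDiag
  rw [if_neg (by omega), Finset.sum_eq_single a]
  · rw [gammaA_rec (by omega) (by omega), if_pos (by omega), gammaA_eq_zero (by omega),
      gammaA_eq_zero (by omega)]
    rfl
  · intro i hi hia
    rw [Finset.mem_range] at hi
    exact gammaA_eq_zero (by omega)
  · intro h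
    simp at h
    omega

theorem gammaDiag_eq_one' {m a b : ℕ} (h : a + b = 2 * m + 1) : gammaDiag m a b = 1 := if_pos h

/-- `P` is the bottom left vertex of a labelled box of `Γ_{D_n}`. -/
def IsBox (n : ℕ) (P : Vertex) : Prop :=
  (P.u = 1 ∧ P.v = 0 ∧ P.x < P.y ∧ P.y ≤ n - 2) ∨
  (P.u = 2 ∧ 1 ≤ P.v ∧ P.v ≤ P.x + 1 ∧ P.x + 1 ≤ n - 1 ∧ P.y = 0) ∨
  (P.u = 3 ∧ 1 ≤ P.v ∧ P.v ≤ n - 1 ∧ P.x + 1 ≤ n - 1 ∧ P.y = 0) ∨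
  (P.u = 4 ∧ P.v = 0 ∧ n - 2 ≤ P.y ∧ P.x + P.y + 5 ≤ 2 * n)

section Count

variable (n : ℕ) (Q : Vertex)

/-- The number of paths from `(a, b)_{(4, 0)}` to `Q`. -/
def count4 (a b : ℕ) : ℤ := if Q.u = 4 then gammaB n a b Q.x Q.y else 0

/-- The number of paths from `(x, 1)_{(3, v)}` to `Q`. -/
def count3t (x v : ℕ) : ℤ := count4 n Q (min (max x (v - 1)) (n - 2)) (n - 2)

/-- The number of paths from `(x, 0)_{(3, v)}` to `Q`. -/
def count3 (x v : ℕ) : ℤ :=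
  -- Walking east along the row, the term of column i accounts for a hit at Q in that column and for
  -- the paths that go north there.
  ∑ i ∈ Finset.Ico x n, ((if (⟨i, 0, 3, v⟩ : Vertex) = Q then 1 else 0) + count3t n Q i v)

/-- The number of paths from `(x, 1)_{(2, v)}` to `Q`. -/
def count2t (x v : ℕ) : ℤ := count3 n Q (v - 1) (min (x + 1) (n - 1))

/-- The number of paths from `(x, 0)_{(2, v)}` to `Q`. -/
def count2 (x v : ℕ) : ℤ :=
  ∑ i ∈ Finset.Ico x n, ((if (⟨i, 0, 2, v⟩ : Vertex) = Q then 1 else 0) + count2t n Q i v)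

/-- The number of paths from `(x, y)_{(1, 0)}` to `Q`. -/
def count1 (x y : ℕ) : ℤ :=
  (if Q.u = 1 then gammaA x y Q.x Q.y else 0) +
    ∑ k ∈ Finset.range (n - 1), gammaTop n x y k * count2 n Q k (k + 1)

/-- The number of paths from `P` to `Q`. -/
def count (P : Vertex) : ℤ :=
  if P.u = 1 then count1 n Q P.x P.y
  else if P.u = 2 then (if P.y = 0 then count2 n Q P.x P.v else count2t n Q P.x P.v)
  else if P.u = 3 then (if P.y = 0 then count3 n Q P.x P.v else count3t n Q P.x P.v)
  else count4 n Q P.x P.y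

end Count

/-- The restriction on Q matters: the closed expressions carry no source term for targets at height
1 of a middle row, and in the top part they are checked only for F and for targets strictly below
the antidiagonal. -/
theorem pathRec_count {n : ℕ} (hn : 3 ≤ n) {Q : Vertex} (hQ : Q = sink n ∨ IsBox n Q) :
    PathRec n (count n Q) (fun P => if P = Q then 1 else 0) := by
  have hy2 : ∀ x v, (⟨x, 1, 2, v⟩ : Vertex) ≠ Q := by
    rintro x v rfl
    simp [sink, IsBox] at hQ
  have hy3 : ∀ x v, (⟨x, 1, 3, v⟩ : Vertex) ≠ Q := by
    rintro x v rfl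
    simp [sink, IsBox] at hQ
  have hy1 : ∀ x y, (⟨x, y, 1, 0⟩ : Vertex) = Q ↔ Q.u = 1 ∧ x = Q.x ∧ y = Q.y := by
    intro x y
    obtain ⟨c, d, u, v⟩ := Q
    simp [sink, IsBox] at hQ ⊢
    omega
  have h1 : Q.u = 1 → Q.x < Q.y ∧ Q.y ≤ n - 2 := by
    intro h
    rcases hQ with rfl | hQ
    · simp [sink] at h
    · unfold IsBox at hQ
      omega
  have h4 : Q.u = 4 → Q.y ≠ 2 * n - 4 →
      Q.v = 0 ∧ n - 2 ≤ Q.y ∧ Q.x + Q.y + 5 ≤ 2 * n := by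
    intro h h'
    rcases hQ with rfl | hQ
    · simp [sink] at h'
    · unfold IsBox at hQ
      omega
  have h4' : Q.u = 4 → Q.y = 2 * n - 4 → Q = ⟨1, 2 * n - 4, 4, 0⟩ := by
    intro h h'
    rcases hQ with rfl | hQ
    · rfl
    · unfold IsBox at hQ
      omega
  have hnot4 : Q.u ≠ 4 → ∀ x y, (⟨x, y, 4, 0⟩ : Vertex) ≠ Q := by
    rintro h x y rfl
    exact h rfl
  have hy4 : Q.y ≠ 2 * n - 4 → Q.u = 4 →
      ∀ x y, (⟨x, y, 4, 0⟩ : Vertex) = Q ↔ x = Q.x ∧ y = Q.y := by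
    intro h h' x y
    have := h4 h' h
    obtain ⟨c, d, u, v⟩ := Q
    simp at this h' ⊢
    omega
  constructor
  · intro x y hxy hy
    simp only [count, count1, if_true, hy1]
    have : ∑ k ∈ Finset.range (n - 1), gammaTop n x y k * count2 n Q k (k + 1)
        = ∑ k ∈ Finset.range (n - 1), gammaTop n (x + 1) y k * count2 n Q k (k + 1)
          + ∑ k ∈ Finset.range (n - 1), gammaTop n x (y + 1) k * count2 n Q k (k + 1) := by
      rw [← Finset.sum_add_distrib]
      refine Finset.sum_congr rfl fun k hk => ?_
      rw [Finset.mem_range] at hk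
      rw [gammaTop_rec hn hxy.le hy (by omega)]
      ring
    rw [this]
    by_cases hu : Q.u = 1
    · rw [if_pos hu, if_pos hu, if_pos hu, gammaA_rec hxy.le (h1 hu).1.le]
      simp only [hu, true_and]
      ring
    · simp [hu]
  · intro x hx hxn
    simp only [count, count1, if_true, hy1]
    have : ∑ k ∈ Finset.range (n - 1), gammaTop n x x k * count2 n Q k (k + 1)
        = ∑ k ∈ Finset.range (n - 1), gammaTop n x (x + 1) k * count2 n Q k (k + 1) := by
      refine Finset.sum_congr rfl fun k hk => ?_
      rw [Finset.mem_range] at hk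
      rw [gammaTop_diag hn hxn (by omega)]
    rw [this]
    by_cases hu : Q.u = 1
    · rw [if_pos hu, if_pos hu, gammaA_diag (h1 hu).1.le]
      simp only [hu, true_and]
      ring
    · simp [hu]
  · intro x hx
    have : (if Q.u = 1 then gammaA x (n - 1) Q.x Q.y else 0) = 0 := by
      split_ifs with hu
      · exact gammaA_eq_zero (by have := h1 hu; omega)
      · rfl
    have h' : ¬(Q.u = 1 ∧ x = Q.x ∧ n - 1 = Q.y) := by
      rintro ⟨hu, -, h⟩
      have := h1 hu
      omega
    simp only [count, count1, if_true, hy1, this, if_neg h']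
    simp only [gammaTop, if_true, ite_mul, one_mul, zero_mul, Finset.sum_ite_eq, Finset.mem_range]
    rw [if_pos (by omega)]
    simp
  · intro x v h1 h2 h3
    simp only [count, count2]
    simp only [OfNat.ofNat_ne_one, if_false, if_true, one_ne_zero]
    rw [Finset.sum_eq_sum_Ico_succ_bot (by omega)]
    ring
  · intro v h1 h2
    simp only [count, count2]
    simp only [OfNat.ofNat_ne_one, if_false, if_true, one_ne_zero]
    rw [Finset.sum_eq_sum_Ico_succ_bot (by omega), show n - 1 + 1 = n by omega]
    simp
  · intro x v h1 h2 h3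
    simp [count, count2t, hy2, h3]
  · intro v h1 h2
    -- The minimum in `count2t` absorbs the west edge: columns n - 2 and n - 1 lead to the same
    -- copy.
    have e2 : min (n - 2 + 1) (n - 1) = n - 1 := by omega
    simp [count, count2t, hy2, e2]
  · intro x v h1 h2 h3
    simp only [count, count3]
    simp only [OfNat.ofNat_ne_one, if_false, if_true, one_ne_zero, Nat.reduceEqDiff]
    rw [Finset.sum_eq_sum_Ico_succ_bot (by omega)]
    ring
  · intro v h1 h2
    simp only [count, count3]
    simp only [OfNat.ofNat_ne_one, if_false, if_true, one_ne_zero, Nat.reduceEqDiff]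
    rw [Finset.sum_eq_sum_Ico_succ_bot (by omega), show n - 1 + 1 = n by omega]
    simp
  · intro x v h1 h2
    -- The maximum in `count3t` absorbs the east edges at height 1, which lead up to column v - 1.
    have e : max x (v - 1) = max (x + 1) (v - 1) := by omega
    simp [count, count3t, hy3, e]
  · intro x v h1 h2 h3
    have e : min (max x (v - 1)) (n - 2) = x := by omega
    simp [count, count3t, hy3, e]
  · intro v h1 h2
    have e1 : min (max (n - 1) (v - 1)) (n - 2) = n - 2 := by omega
    simp [count, count3t, hy3, e1]
  -- The five shapes of the top part. On and beyond the antidiagonal there is exactly one path to F,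
  -- and none to a box.
  all_goals
    by_cases hu : Q.u = 4
    swap
    · simp [count, count4, hu, hnot4]
    by_cases hd : Q.y = 2 * n - 4
    · have hQ' := h4' hu hd
      subst hQ'
      intros
      simp only [count, count4, gammaB, Vertex.mk.injEq]
      simp only [OfNat.ofNat_ne_one, if_false, if_true, Nat.reduceEqDiff, and_true, and_self]
      first
      | rw [gammaDiag_rec (by omega) (by omega), if_neg (by omega), zero_add]
      | rw [gammaDiag_eq_one (by omega) (by omega), gammaDiag_eq_one' (by omega),
          if_neg (by omega), zero_add]
      | rw [gammaDiag_eq_one' (by omega), gammaDiag_eq_one (by omega) (by omega),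
          if_neg (by omega), zero_add]
      | rw [gammaDiag_eq_one (by omega) (by omega), gammaDiag_eq_one' (by omega), zero_add]
      | rw [gammaDiag_eq_one' (by omega)]
    · have hQ' := h4 hu hd
      intros
      simp only [count, count4, gammaB, hy4 hd hu, hd, hu]
      simp only [OfNat.ofNat_ne_one, if_false, if_true, Nat.reduceEqDiff, and_false]
      first
      | rw [gammaA_eq_zero (by omega), gammaA_eq_zero (by omega), if_neg (by omega), zero_add]
      | rw [gammaA_eq_zero (by omega), if_neg (by omega)]
      | rw [gammaA_rec (by omega) (by omega)]

/-! ### Comparison with the explicit formula -/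

/-- Going up in any of the columns k, …, j - 1 ends in column j - 1, and column n - 1 folds back
onto n - 2, which therefore occurs once more. -/
theorem sum_min_max (T : ℕ → ℤ) {n k j : ℕ} (hk : k < j) (hj : j ≤ n - 1) :
    ∑ x ∈ Finset.Ico k n, T (min (max x (j - 1)) (n - 2))
      = ((j : ℤ) - k) * T (j - 1) + (∑ i ∈ Finset.Ico j (n - 1), T i + T (n - 2)) := by
  rw [← Finset.sum_Ico_consecutive _ hk.le (show j ≤ n by omega)]
  congr 1
  · rw [Finset.sum_congr rfl (g := fun _ => T (j - 1))]
    · rw [Finset.sum_const, Nat.card_Ico, nsmul_eq_mul, Nat.cast_sub hk.le]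
    · intro x hx
      rw [Finset.mem_Ico] at hx
      congr 1
      omega
  · obtain ⟨m, rfl⟩ : ∃ m, n = m + 1 := ⟨n - 1, by omega⟩
    rw [Finset.sum_Ico_succ_top (by omega), Nat.add_sub_cancel]
    congr 1
    · refine Finset.sum_congr rfl fun x hx => ?_
      rw [Finset.mem_Ico] at hx
      congr 1
      omega
    · congr 1
      omega

/-- The coefficient λ is a multiplicity: the number of columns x ≥ k of the lower middle row from
which the top part is entered in column i. -/
theorem sum_coeffLambda (T : ℕ → ℤ) {n k j : ℕ} (hk : k < j) (hj : j ≤ n - 1) :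
    ∑ x ∈ Finset.Ico k n, T (min (max x (j - 1)) (n - 2))
      = ∑ i ∈ Finset.Ico (j - 1) (n - 1), coeffLambda n i j k * T i := by
  have h : ∀ i, coeffLambda n i j k * T i
      = (if i + 1 = j then (j : ℤ) - k else 1) * T i + (if i = n - 2 then T i else 0) := by
    intro i
    unfold coeffLambda
    split_ifs <;> ring
  rw [sum_min_max T hk hj, Finset.sum_congr rfl fun i _ => h i, Finset.sum_add_distrib,
    Finset.sum_ite_eq', if_pos (by rw [Finset.mem_Ico]; omega), ← add_assoc]
  congr 1
  rw [Finset.sum_eq_sum_Ico_succ_bot (show j - 1 < n - 1 by omega), if_pos (by omega),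
    show j - 1 + 1 = j by omega]
  congr 1
  refine Finset.sum_congr rfl fun i hi => ?_
  rw [Finset.mem_Ico] at hi
  rw [if_neg (by omega), one_mul]

/-- The coefficient μ is 2 for the copy n - 1, which is reached both from column n - 2 and, through
the west edge, from column n - 1. -/
theorem sum_coeffMu (S : ℕ → ℤ) {n k : ℕ} (hk : k ≤ n - 2) (hn : 3 ≤ n) :
    ∑ x ∈ Finset.Ico k n, S (min (x + 1) (n - 1))
      = ∑ j ∈ Finset.Ico (k + 1) n, coeffMu n j * S j := by
  have h : ∀ j, coeffMu n j * S j = S j + (if j = n - 1 then S j else 0) := by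
    intro j
    unfold coeffMu
    split_ifs <;> ring
  rw [Finset.sum_congr rfl fun j _ => h j, Finset.sum_add_distrib, Finset.sum_ite_eq',
    if_pos (by rw [Finset.mem_Ico]; omega)]
  obtain ⟨m, rfl⟩ : ∃ m, n = m + 1 := ⟨n - 1, by omega⟩
  rw [Finset.sum_Ico_succ_top (by omega), ← Finset.sum_Ico_add' S k m 1]
  simp only [Nat.add_sub_cancel]
  congr 1
  · refine Finset.sum_congr rfl fun x hx => ?_
    rw [Finset.mem_Ico] at hx
    congr 1
    omega
  · congr 1
    omega

/-- Here k is the exit column of the bottom part, j the copy of the lower middle row, and i the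
column where the top part is entered. -/
theorem sum_top_eq_gammaD {n : ℕ} (hn : 3 ≤ n) (a b c d : ℕ) :
    ∑ k ∈ Finset.range (n - 1), gammaTop n a b k *
      ∑ x ∈ Finset.Ico k n, ∑ x' ∈ Finset.Ico k n,
        gammaB n (min (max x' (min (x + 1) (n - 1) - 1)) (n - 2)) (n - 2) c d
      = gammaD n a b c d := by
  have h : ∀ k ∈ Finset.range (n - 1), gammaTop n a b k *
      ∑ x ∈ Finset.Ico k n, ∑ x' ∈ Finset.Ico k n,
        gammaB n (min (max x' (min (x + 1) (n - 1) - 1)) (n - 2)) (n - 2) c d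
      = ∑ j ∈ Finset.Ico (k + 1) n, ∑ i ∈ Finset.Ico (j - 1) (n - 1),
        coeffMu n j * coeffLambda n i j k * gammaTop n a b k * gammaB n i (n - 2) c d := by
    intro k hk
    rw [Finset.mem_range] at hk
    rw [sum_coeffMu (fun j => ∑ x' ∈ Finset.Ico k n,
      gammaB n (min (max x' (j - 1)) (n - 2)) (n - 2) c d) (by omega) hn, Finset.mul_sum]
    refine Finset.sum_congr rfl fun j hj => ?_
    rw [Finset.mem_Ico] at hj
    rw [sum_coeffLambda (fun i => gammaB n i (n - 2) c d) (by omega) (by omega), Finset.mul_sum,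
      Finset.mul_sum]
    refine Finset.sum_congr rfl fun i _ => ?_
    ring
  rw [Finset.sum_congr rfl h]
  unfold gammaD
  simp only [Finset.sum_sigma']
  -- Both triple sums run over k < j ≤ i + 1 ≤ n - 1, in opposite orders of summation.
  refine Finset.sum_bij' (fun s _ => ⟨s.2.2, s.2.1, s.1⟩) (fun s _ => ⟨s.2.2, s.2.1, s.1⟩)
    ?_ ?_ ?_ ?_ ?_
  · rintro ⟨k, j, i⟩ h
    simp at h ⊢
    omega
  · rintro ⟨i, j, k⟩ h
    simp at h ⊢
    omega
  · intros; rfl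
  · intros; rfl
  · intros; rfl

theorem count_eq_gammaFormula {n : ℕ} (hn : 3 ≤ n) {P Q : Vertex}
    (hP : P = source ∨ ∃ C, IsBox n C ∧ P = C.tr) (hQ : Q = sink n ∨ IsBox n Q) :
    count n Q P = gammaFormula n P Q := by
  -- In the middle rows P has height 1 and Q has height 0, so no path joins them inside one row. The
  -- sixteen pairs of parts are then compared one by one.
  have hP' : (P.u = 1 ∧ P.v = 0 ∧ P.x < P.y ∧ P.y ≤ n - 1) ∨
      (P.u = 2 ∧ 1 ≤ P.v ∧ P.v ≤ P.x ∧ P.x ≤ n - 1 ∧ P.y = 1) ∨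
      (P.u = 3 ∧ 1 ≤ P.v ∧ P.v ≤ n - 1 ∧ P.x ≤ n - 1 ∧ P.y = 1) ∨ P.u = 4 := by
    rcases hP with rfl | ⟨C, hC, rfl⟩
    · simp [source]
      omega
    · simp only [IsBox, Vertex.tr] at hC ⊢
      omega
  have hQ' : (Q.u = 1 ∧ Q.v = 0 ∧ Q.x < Q.y ∧ Q.y ≤ n - 2) ∨
      (Q.u = 2 ∧ 1 ≤ Q.v ∧ Q.v ≤ Q.x + 1 ∧ Q.x + 1 ≤ n - 1 ∧ Q.y = 0) ∨
      (Q.u = 3 ∧ 1 ≤ Q.v ∧ Q.v ≤ n - 1 ∧ Q.x + 1 ≤ n - 1 ∧ Q.y = 0) ∨ Q.u = 4 := by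
    rcases hQ with rfl | hQ
    · simp [sink]
    · unfold IsBox at hQ
      omega
  obtain ⟨x, y, u, v⟩ := P
  obtain ⟨c, d, s, t⟩ := Q
  simp only at hP' hQ'
  clear hP hQ
  rcases hP' with ⟨rfl, rfl, p1, p2⟩ | ⟨rfl, p1, p2, p3, rfl⟩ | ⟨rfl, p1, p2, p3, rfl⟩ | rfl <;>
  rcases hQ' with ⟨rfl, rfl, q1, q2⟩ | ⟨rfl, q1, q2, q3, rfl⟩ | ⟨rfl, q1, q2, q3, rfl⟩ | rfl
  · simp [count, gammaFormula, count1, count2, count2t, count3, count3t, count4]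
  · have hs : ∀ k ∈ Finset.range (n - 1), gammaTop n x y k * count2 n ⟨c, 0, 2, t⟩ k (k + 1)
        = if k = t - 1 then gammaTop n x y k else 0 := by
      intro k hk
      have : ∀ i, (i = c ∧ k + 1 = t) ↔ i = c ∧ k = t - 1 := by omega
      simp only [count2, count2t, count3, count3t, count4]
      simp only [Vertex.mk.injEq, true_and, Nat.reduceEqDiff, false_and,
        and_false, if_false, add_zero, Finset.sum_const_zero, this]
      split_ifs with h
      · subst h
        simp only [and_true, Finset.sum_ite_eq', Finset.mem_Ico]
        rw [if_pos (by omega), mul_one]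
      · simp [h]
    simp only [count, gammaFormula, count1, Finset.sum_congr rfl hs]
    simp
    omega
  · have hs : ∀ k ∈ Finset.range (n - 1), gammaTop n x y k * count2 n ⟨c, 0, 3, t⟩ k (k + 1)
        = if k ∈ Finset.range (min c (t - 1) + 1) then
            coeffMu n t * gammaTop n x y k else 0 := by
      intro k hk
      rw [Finset.mem_range] at hk
      simp only [count2, count2t, count3, count3t, count4]
      simp only [Vertex.mk.injEq, true_and, Nat.reduceEqDiff, false_and,
        and_false, if_false, add_zero, zero_add, Nat.add_sub_cancel]
      rw [sum_coeffMu (fun j => ∑ i ∈ Finset.Ico k n, if i = c ∧ j = t then (1 : ℤ) else 0)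
        (by omega) hn]
      have : ∀ j, coeffMu n j * ∑ i ∈ Finset.Ico k n, (if i = c ∧ j = t then (1 : ℤ) else 0)
          = if j = t then (if k ≤ c then coeffMu n j else 0) else 0 := by
        intro j
        split_ifs with h1 h2
        · simp only [h1, and_true, Finset.sum_ite_eq', Finset.mem_Ico]
          rw [if_pos (by omega), mul_one]
        · simp only [h1, and_true, Finset.sum_ite_eq', Finset.mem_Ico]
          rw [if_neg (by omega), mul_zero]
        · simp [h1]
      rw [Finset.sum_congr rfl fun j _ => this j, Finset.sum_ite_eq']
      simp only [Finset.mem_Ico, Finset.mem_range]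
      by_cases h1 : k ≤ c
      · by_cases h2 : k + 1 ≤ t
        · rw [if_pos (by omega), if_pos h1, if_pos (by omega), mul_comm]
        · rw [if_neg (by omega), if_neg (by omega), mul_zero]
      · rw [if_neg h1, ite_self, if_neg (by omega), mul_zero]
    have hsub : Finset.range (n - 1) ∩ Finset.range (min c (t - 1) + 1)
        = Finset.range (min c (t - 1) + 1) := by
      rw [Finset.inter_eq_right]
      intro k
      simp only [Finset.mem_range]
      omega
    simp only [count, gammaFormula, count1, Finset.sum_congr rfl hs, Finset.sum_ite_mem, hsub]
    by_cases ht : t = n - 1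
    · simp [coeffMu, ht]
    · simp [coeffMu, ht]
  · simp only [count, gammaFormula, count1, count2, count2t, count3, count3t, count4]
    simp only [Vertex.mk.injEq, Nat.reduceEqDiff, false_and, and_false, if_false, zero_add, if_true,
      Nat.add_sub_cancel, OfNat.ofNat_ne_one, and_self, sum_top_eq_gammaD hn]
  · simp [count, gammaFormula, count2t, count3, count3t, count4]
  · simp [count, gammaFormula, count2t, count3, count3t, count4]
  · simp only [count, gammaFormula, count2t, count3, count3t, count4]
    simp only [Vertex.mk.injEq, Nat.reduceEqDiff, false_and, and_false, if_false, if_true,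
      OfNat.ofNat_ne_one, and_self, true_and, add_zero, one_ne_zero]
    by_cases h : t = min (x + 1) (n - 1)
    · simp only [← h, and_true, Finset.sum_ite_eq', Finset.mem_Ico]
      by_cases h' : v - 1 ≤ c
      · rw [if_pos (by omega), if_pos h']
      · rw [if_neg (by omega), if_neg h']
    · simp [h, Ne.symm h]
  · simp only [count, gammaFormula, count2t, count3, count3t, count4]
    simp only [Vertex.mk.injEq, Nat.reduceEqDiff, false_and, and_false, if_false, if_true,
      OfNat.ofNat_ne_one, and_self, true_and, zero_add, one_ne_zero]
    rw [sum_min_max (fun i => gammaB n i (n - 2) c d) (by omega) (by omega)]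
    by_cases h : n - 2 ≤ x
    · rw [if_pos h, show min (x + 1) (n - 1) = n - 1 by omega, Finset.Ico_self, Finset.sum_empty,
        show n - 1 - 1 = n - 2 by omega, Nat.cast_sub (by omega), Nat.cast_sub p1]
      push_cast
      ring
    · rw [if_neg h, if_pos (by omega), show min (x + 1) (n - 1) = x + 1 by omega,
        Nat.add_sub_cancel, Nat.cast_sub p1,
        show Finset.Icc (x + 1) (n - 3) = Finset.Ico (x + 1) (n - 2) by ext; simp; omega,
        show n - 1 = (n - 2) + 1 by omega, Finset.sum_Ico_succ_top (by omega)]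
      push_cast
      ring
  · simp [count, gammaFormula, count3t, count4]
  · simp [count, gammaFormula, count3t, count4]
  · simp [count, gammaFormula, count3t, count4]
  · simp only [count, gammaFormula, count3t, count4]
    simp only [Nat.reduceEqDiff, false_and, if_false, if_true,
      OfNat.ofNat_ne_one, and_self, true_and, one_ne_zero]
    split_ifs <;> (first | omega | (congr 1; omega))
  · simp [count, gammaFormula, count4]
  · simp [count, gammaFormula, count4]
  · simp [count, gammaFormula, count4]
  · simp [count, gammaFormula, count4]

/-! ### Counting antichains -/

section Antichains

variable {α : Type*} [PartialOrder α]

open Classical in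
/-- The antichains of a finite subset of a poset. -/
noncomputable def antichains (S : Finset α) : Finset (Finset α) :=
  S.powerset.filter fun A => IsAntichain (· ≤ ·) (A : Set α)

theorem mem_antichains {S A : Finset α} :
    A ∈ antichains S ↔ A ⊆ S ∧ IsAntichain (· ≤ ·) (A : Set α) := by
  simp [antichains]

/-- By comparability no antichain meets both differences, so each one lies in U or in V, and
inclusion-exclusion applies. -/
theorem card_antichains_union [DecidableEq α] (U V : Finset α)
    (h : ∀ u ∈ U, u ∉ V → ∀ v ∈ V, v ∉ U → u ≤ v ∨ v ≤ u) :
    (antichains (U ∪ V)).card + (antichains (U ∩ V)).card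
      = (antichains U).card + (antichains V).card := by
  have h1 : antichains (U ∪ V) = antichains U ∪ antichains V := by
    ext A
    simp only [Finset.mem_union, mem_antichains, ← or_and_right]
    refine and_congr_left fun hA => ⟨fun hs => ?_, ?_⟩
    · by_contra hcon
      push Not at hcon
      obtain ⟨⟨v, hv, hvU⟩, u, hu, huV⟩ := Finset.not_subset.1 hcon.1, Finset.not_subset.1 hcon.2
      have hu' := (Finset.mem_union.1 (hs hu)).resolve_right huV
      have hv' := (Finset.mem_union.1 (hs hv)).resolve_left hvU
      have hne : u ≠ v := fun e => hvU (e ▸ hu')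
      rcases h u hu' huV v hv' hvU with hle | hle
      · exact hA hu hv hne hle
      · exact hA hv hu hne.symm hle
    · rintro (hs | hs)
      · exact hs.trans Finset.subset_union_left
      · exact hs.trans Finset.subset_union_right
  have h2 : antichains (U ∩ V) = antichains U ∩ antichains V := by
    ext A
    simp only [Finset.mem_inter, mem_antichains, Finset.subset_inter_iff]
    tauto
  rw [h1, h2, Finset.card_union_add_card_inter]

open Classical in
theorem card_antichains_insert [DecidableEq α] (s : α) (S : Finset α) (hs : s ∉ S) :
    (antichains (insert s S)).card
      = (antichains S).card + (antichains (S.filter fun t => ¬ t ≤ s ∧ ¬ s ≤ t)).card := by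
  have h1 : antichains (insert s S) = antichains S ∪
      (antichains (S.filter fun t => ¬ t ≤ s ∧ ¬ s ≤ t)).image (insert s) := by
    ext A
    simp only [Finset.mem_union, Finset.mem_image, mem_antichains]
    constructor
    · rintro ⟨hA, hA'⟩
      by_cases h : s ∈ A
      · refine Or.inr ⟨A.erase s, ⟨fun t ht => ?_, ?_⟩, Finset.insert_erase h⟩
        · rw [Finset.mem_erase] at ht
          rw [Finset.mem_filter]
          exact ⟨(Finset.mem_insert.1 (hA ht.2)).resolve_left ht.1, hA' ht.2 h ht.1,
            hA' h ht.2 ht.1.symm⟩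
        · exact hA'.subset (Finset.coe_subset.2 (Finset.erase_subset _ _))
      · exact Or.inl ⟨(Finset.subset_insert_iff_of_notMem h).1 hA, hA'⟩
    · rintro (⟨hA, hA'⟩ | ⟨B, ⟨hB, hB'⟩, rfl⟩)
      · exact ⟨hA.trans (Finset.subset_insert _ _), hA'⟩
      · refine ⟨Finset.insert_subset_insert _ (hB.trans (Finset.filter_subset _ _)), ?_⟩
        rw [Finset.coe_insert, isAntichain_insert]
        exact ⟨hB', fun t ht _ => (Finset.mem_filter.1 (hB ht)).2.symm⟩
  rw [h1, Finset.card_union_of_disjoint, Finset.card_image_of_injOn]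
  · intro A hA B hB hAB
    have hnot : ∀ A ∈ antichains (S.filter fun t => ¬ t ≤ s ∧ ¬ s ≤ t), s ∉ A := by
      intro A hA h
      exact hs (Finset.mem_filter.1 ((mem_antichains.1 hA).1 h)).1
    rw [← Finset.erase_insert (hnot A hA), ← Finset.erase_insert (hnot B hB), hAB]
  · rw [Finset.disjoint_left]
    intro A hA hA'
    obtain ⟨B, _, rfl⟩ := Finset.mem_image.1 hA'
    exact hs ((mem_antichains.1 hA).1 (Finset.mem_insert_self _ _))

open Classical in
/-- The number of antichains of `T` whose elements satisfy `p`. -/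
noncomputable def antichainCount (T : Finset α) (p : α → Prop) : ℤ :=
  ((antichains (T.filter p)).card : ℤ)

theorem antichainCount_congr {T : Finset α} {p q : α → Prop} (h : ∀ t ∈ T, p t ↔ q t) :
    antichainCount T p = antichainCount T q := by
  classical
  unfold antichainCount
  rw [Finset.filter_congr h]

theorem antichainCount_eq_one {T : Finset α} {p : α → Prop} (h : ∀ t ∈ T, ¬ p t) :
    antichainCount T p = 1 := by
  have : ∀ S : Finset α, S = ∅ → antichains S = {∅} := by
    rintro S rfl
    ext A
    rw [mem_antichains, Finset.mem_singleton, Finset.subset_empty]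
    exact and_iff_left_of_imp (by rintro rfl; simp)
  classical
  unfold antichainCount
  rw [this _ (Finset.filter_eq_empty_iff.2 fun {x} hx => h x hx)]
  simp

/-- The contribution of one box. The antichains through s are counted by pD, because pD singles out
the elements incomparable with s; they cancel the inclusion-exclusion term exactly when s ∈ T. -/
theorem antichainCount_diamond [DecidableEq α] {T : Finset α} (s : α) {pX pU pV pD : α → Prop}
    (hX : ∀ t ∈ T, pX t ↔ t = s ∨ pU t ∨ pV t) (hU : ¬ pU s) (hV : ¬ pV s)
    (hD : ∀ t ∈ T, pD t ↔ pU t ∧ pV t)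
    (hs : ∀ t ∈ T, pU t ∨ pV t → (pD t ↔ ¬ t ≤ s ∧ ¬ s ≤ t))
    (huv : ∀ u ∈ T, ∀ v ∈ T, pU u → ¬ pV u → pV v → ¬ pU v → u ≤ v ∨ v ≤ u) :
    antichainCount T pX = antichainCount T pU + antichainCount T pV
      - (if s ∈ T then 0 else antichainCount T pD) := by
  classical
  have hunion := card_antichains_union (T.filter pU) (T.filter pV) (by
    intro u hu huV v hv hvU
    simp only [Finset.mem_filter, not_and] at hu huV hv hvU
    exact huv u hu.1 v hv.1 hu.2 (huV hu.1) hv.2 (hvU hv.1))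
  have hD' : T.filter pU ∩ T.filter pV = T.filter pD := by
    rw [← Finset.filter_and]
    exact Finset.filter_congr fun t ht => (hD t ht).symm
  rw [hD'] at hunion
  unfold antichainCount
  split_ifs with h
  · have hX' : T.filter pX = insert s (T.filter pU ∪ T.filter pV) := by
      ext t
      simp only [Finset.mem_filter, Finset.mem_insert, Finset.mem_union]
      constructor
      · rintro ⟨h1, h2⟩
        rw [hX t h1] at h2
        tauto
      · rintro (rfl | h1 | h1)
        · exact ⟨h, (hX _ h).2 (Or.inl rfl)⟩
        · exact ⟨h1.1, (hX _ h1.1).2 (Or.inr (Or.inl h1.2))⟩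
        · exact ⟨h1.1, (hX _ h1.1).2 (Or.inr (Or.inr h1.2))⟩
    have hD2 : (T.filter pU ∪ T.filter pV).filter (fun t => ¬ t ≤ s ∧ ¬ s ≤ t) = T.filter pD := by
      ext t
      simp only [Finset.mem_filter, Finset.mem_union]
      constructor
      · rintro ⟨h1, h2⟩
        have h3 : t ∈ T := by tauto
        exact ⟨h3, (hs t h3 (by tauto)).2 h2⟩
      · rintro ⟨h1, h2⟩
        have := (hD t h1).1 h2
        exact ⟨Or.inl ⟨h1, this.1⟩, (hs t h1 (Or.inl this.1)).1 h2⟩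
    rw [hX', card_antichains_insert s _ (by simp [hU, hV]), hD2]
    push_cast
    omega
  · have hX' : T.filter pX = T.filter pU ∪ T.filter pV := by
      rw [← Finset.filter_or]
      refine Finset.filter_congr fun t ht => ?_
      rw [hX t ht]
      refine or_iff_right ?_
      rintro rfl
      exact h ht
    rw [hX']
    omega

end Antichains

/-! ### The poset of positive roots -/

/-- The index `(a, b)` stands for the root `e_a - e_b` if `b ≤ n`, and for the root
`e_a + e_{2n+1-b}` if `n < b`. -/
@[ext] structure RootIndex (n : ℕ) where
  a : ℕ
  b : ℕ
deriving DecidableEq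

/-- The root order. -/
instance (n : ℕ) : PartialOrder (RootIndex n) where
  -- Interval containment, except that e_a - e_n and e_b + e_n, adjacent in the b-coordinate, are
  -- never comparable.
  le p q := q.a ≤ p.a ∧ p.b ≤ q.b ∧ ¬(p.b = n ∧ q.b = n + 1)
  le_refl p := by refine ⟨le_rfl, le_rfl, by omega⟩
  le_trans p q r := by
    rintro ⟨h1, h2, h3⟩ ⟨h4, h5, h6⟩
    exact ⟨by omega, by omega, by omega⟩
  le_antisymm p q := by
    rintro ⟨h1, h2, h3⟩ ⟨h4, h5, h6⟩
    ext <;> omega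

theorem RootIndex.le_iff {n : ℕ} {p q : RootIndex n} :
    p ≤ q ↔ q.a ≤ p.a ∧ p.b ≤ q.b ∧ ¬(p.b = n ∧ q.b = n + 1) := Iff.rfl

/-- The indices of the positive roots. -/
def rootIndices (n : ℕ) : Finset (RootIndex n) :=
  ((Finset.range (2 * n + 1) ×ˢ Finset.range (2 * n + 1)).filter
    fun p => 1 ≤ p.1 ∧ p.1 < p.2 ∧ p.1 + p.2 ≤ 2 * n).image fun p => ⟨p.1, p.2⟩

theorem mem_rootIndices {n : ℕ} {p : RootIndex n} :
    p ∈ rootIndices n ↔ 1 ≤ p.a ∧ p.a < p.b ∧ p.a + p.b ≤ 2 * n := by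
  simp only [rootIndices, Finset.mem_image, Finset.mem_filter, Finset.mem_product,
    Finset.mem_range, Prod.exists]
  constructor
  · rintro ⟨a, b, h, rfl⟩
    exact h.2
  · intro h
    exact ⟨p.a, p.b, ⟨⟨by omega, by omega⟩, h⟩, rfl⟩

/-- The root that labels the box with the bottom left vertex `P`. -/
def boxLabel (n : ℕ) (P : Vertex) : RootIndex n :=
  if P.u = 1 then ⟨P.x + 1, P.y + 1⟩
  else if P.u = 2 then ⟨P.x + 1, n⟩
  else if P.u = 3 then ⟨P.x + 1, n + 1⟩
  else ⟨P.x + 1, P.y + 4⟩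

/-- The roots that can be labels of corners of a path that starts at `P`. -/
def IsAhead (n : ℕ) (P : Vertex) (t : RootIndex n) : Prop :=
  (P.u = 1 ∧ P.x < t.a ∧ P.y < t.b) ∨
  -- In the part (2, v) the lower middle row is still to come and will start in column v - 1. In the
  -- part (3, v) the top part will be entered no further west than both x and v - 1.
  (P.u = 2 ∧ ((t.b = n + 1 ∧ P.v ≤ t.a) ∨ (n + 2 ≤ t.b ∧ P.x < t.a) ∨
    (P.y = 0 ∧ t.b = n ∧ P.x < t.a))) ∨
  (P.u = 3 ∧ ((P.y = 0 ∧ t.b = n + 1 ∧ P.x < t.a) ∨ (n + 2 ≤ t.b ∧ P.x < t.a ∧ P.v ≤ t.a))) ∨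
  (P.u = 4 ∧ P.x < t.a ∧ P.y + 4 ≤ t.b)

/-- At a box this is `antichainCount_diamond`. At every other vertex except F the successor is
unique and has the same members of T ahead, by a < b and a + b ≤ 2n. -/
theorem pathRec_antichainCount {n : ℕ} (hn : 3 ≤ n) {T : Finset (RootIndex n)}
    (hT : T ⊆ rootIndices n) {C : Finset Vertex}
    (hC : ∀ P, P ∈ C ↔ IsBox n P ∧ boxLabel n P ∉ T) :
    PathRec n (fun P => antichainCount T (IsAhead n P)) (fun P =>
      (if P = sink n then 1 else 0) - if P ∈ C then antichainCount T (IsAhead n P.tr) else 0) := by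
  have hT' : ∀ t ∈ T, 1 ≤ t.a ∧ t.a < t.b ∧ t.a + t.b ≤ 2 * n := fun t ht =>
    mem_rootIndices.1 (hT ht)
  have key : ∀ P U V : Vertex, IsBox n P → P ≠ sink n →
      antichainCount T (IsAhead n P) = antichainCount T (IsAhead n U) + antichainCount T (IsAhead n V)
        - (if boxLabel n P ∈ T then 0 else antichainCount T (IsAhead n P.tr)) →
      antichainCount T (IsAhead n P) = ((if P = sink n then 1 else 0) -
        if P ∈ C then antichainCount T (IsAhead n P.tr) else 0) +
        (antichainCount T (IsAhead n U) + antichainCount T (IsAhead n V)) := by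
    intro P U V hP hP' h
    rw [h, if_neg hP']
    simp only [hC, hP, true_and]
    split_ifs <;> ring
  have key' : ∀ P U : Vertex, ¬ IsBox n P → P ≠ sink n →
      (∀ t ∈ T, IsAhead n P t ↔ IsAhead n U t) →
      antichainCount T (IsAhead n P) = ((if P = sink n then 1 else 0) -
        if P ∈ C then antichainCount T (IsAhead n P.tr) else 0) +
        antichainCount T (IsAhead n U) := by
    intro P U hP hP' h
    rw [antichainCount_congr h, if_neg hP']
    simp [hC, hP]
  constructor
  · intro x y h1 h2
    refine key _ _ _ (by simp [IsBox]; omega) (by simp [sink]) ?_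
    apply antichainCount_diamond
    case hX =>
      intro t ht
      have := hT' t ht
      simp [IsAhead, boxLabel, RootIndex.ext_iff]
      omega
    case huv =>
      intro u hu v hv
      have := hT' v hv
      have := hT' u hu
      simp [IsAhead, RootIndex.le_iff]
      omega
    case hU => simp [IsAhead, boxLabel]
    case hV => simp [IsAhead, boxLabel]
    all_goals
      intro t ht
      simp [IsAhead, boxLabel, Vertex.tr, RootIndex.le_iff]
      try omega
  · intro x h1 h2
    refine key' _ _ (by simp [IsBox]) (by simp [sink]) fun t ht => ?_
    have := hT' t ht
    simp [IsAhead]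
    omega
  · intro x h1
    refine key' _ _ (by simp [IsBox]; omega) (by simp [sink]) fun t ht => ?_
    have := hT' t ht
    simp [IsAhead]
    omega
  · intro x v h1 h2 h3
    refine key _ _ _ (by simp [IsBox]; omega) (by simp [sink]) ?_
    apply antichainCount_diamond
    case hX =>
      intro t ht
      have := hT' t ht
      simp [IsAhead, boxLabel, RootIndex.ext_iff]
      omega
    case huv =>
      intro u hu v hv
      have := hT' v hv
      have := hT' u hu
      simp [IsAhead, RootIndex.le_iff]
      omega
    case hU => simp [IsAhead, boxLabel]
    case hV => simp [IsAhead, boxLabel]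
    all_goals
      intro t ht
      simp [IsAhead, boxLabel, Vertex.tr, RootIndex.le_iff]
      try omega
  · intro v h1 h2
    refine key' _ _ (by simp [IsBox]) (by simp [sink]) fun t ht => ?_
    have := hT' t ht
    simp [IsAhead]
    omega
  · intro x v h1 h2 h3
    refine key' _ _ (by simp [IsBox]) (by simp [sink]) fun t ht => ?_
    have := hT' t ht
    simp [IsAhead]
    omega
  · intro v h1 h2
    refine key' _ _ (by simp [IsBox]) (by simp [sink]) fun t ht => ?_
    have := hT' t ht
    simp [IsAhead]
    omega
  · intro x v h1 h2 h3
    refine key _ _ _ (by simp [IsBox]; omega) (by simp [sink]) ?_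
    apply antichainCount_diamond
    case hX =>
      intro t ht
      have := hT' t ht
      simp [IsAhead, boxLabel, RootIndex.ext_iff]
      omega
    case huv =>
      intro u hu v hv
      have := hT' v hv
      have := hT' u hu
      simp [IsAhead, RootIndex.le_iff]
      omega
    case hU => simp [IsAhead, boxLabel]
    case hV => simp [IsAhead, boxLabel]
    all_goals
      intro t ht
      simp [IsAhead, boxLabel, Vertex.tr, RootIndex.le_iff]
      try omega
  · intro v h1 h2
    refine key' _ _ (by simp [IsBox]) (by simp [sink]) fun t ht => ?_
    have := hT' t ht
    simp [IsAhead]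
    omega
  · intro x v h1 h2
    refine key' _ _ (by simp [IsBox]) (by simp [sink]) fun t ht => ?_
    have := hT' t ht
    simp [IsAhead]
    omega
  · intro x v h1 h2 h3
    refine key' _ _ (by simp [IsBox]) (by simp [sink]) fun t ht => ?_
    have := hT' t ht
    simp [IsAhead]
    omega
  · intro v h1 h2
    refine key' _ _ (by simp [IsBox]) (by simp [sink]) fun t ht => ?_
    have := hT' t ht
    simp [IsAhead]
    omega
  · intro x y h1 h2
    refine key _ _ _ (by simp [IsBox]; omega) (by simp [sink]; omega) ?_
    apply antichainCount_diamond
    case hX =>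
      intro t ht
      have := hT' t ht
      simp [IsAhead, boxLabel, RootIndex.ext_iff]
      omega
    case huv =>
      intro u hu v hv
      have := hT' v hv
      have := hT' u hu
      simp [IsAhead, RootIndex.le_iff]
      omega
    case hU => simp [IsAhead, boxLabel]
    case hV => simp [IsAhead, boxLabel]
    all_goals
      intro t ht
      simp [IsAhead, boxLabel, Vertex.tr, RootIndex.le_iff]
      try omega
  · intro x y h1 h2 h3
    refine key' _ _ (by simp [IsBox]; omega) (by simp [sink]; omega) fun t ht => ?_
    have := hT' t ht
    simp [IsAhead]
    omega
  · intro x y h1 h2 h3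
    refine key' _ _ (by simp [IsBox]; omega) (by simp [sink]; omega) fun t ht => ?_
    have := hT' t ht
    simp [IsAhead]
    omega
  · refine key' _ _ (by simp [IsBox]; omega) (by simp [sink]) fun t ht => ?_
    have := hT' t ht
    simp [IsAhead]
    omega
  · have : ¬ IsBox n ⟨1, 2 * n - 4, 4, 0⟩ := by simp [IsBox]; omega
    -- No root is ahead of F, so only the empty antichain is left.
    rw [antichainCount_eq_one]
    · simp [hC, this, sink]
    · intro t ht
      have := hT' t ht
      simp [IsAhead]
      omega

/-! ### Gordan's theorem for integer vectors -/

theorem exists_between_finite {A B : Set ℝ} (hA : A.Finite) (hB : B.Finite)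
    (h : ∀ a ∈ A, ∀ b ∈ B, a < b) : ∃ c, (∀ a ∈ A, a < c) ∧ ∀ b ∈ B, c < b := by
  obtain ⟨c, h1, h2⟩ := Order.exists_between_finsets (lo := hA.toFinset) (hi := hB.toFinset)
    (by simpa using h)
  exact ⟨c, by simpa using h1, by simpa using h2⟩

/-- Either a finite set of integer vectors lies in an open half space, or zero is a nonempty sum of
its elements. -/
theorem gordan (m : ℕ) (L : Set (Fin m → ℤ)) (hL : L.Finite) :
    (∃ y : Fin m → ℝ, ∀ v ∈ L, 0 < ∑ i, (v i : ℝ) * y i) ∨ 0 ∈ AddSubsemigroup.closure L := by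
  induction m with
  | zero =>
    rcases L.eq_empty_or_nonempty with rfl | ⟨v, hv⟩
    · exact Or.inl ⟨0, by simp⟩
    · right
      rw [Subsingleton.elim 0 v]
      exact AddSubsemigroup.subset_closure hv
  | succ m ih =>
    -- Fourier-Motzkin elimination of the first coordinate: keep the vectors in which it vanishes,
    -- and combine each pair of opposite signs with positive integer weights so that it cancels.
    let Z : Set (Fin m → ℤ) := Fin.tail '' {v ∈ L | v 0 = 0}
    let K : Set (Fin m → ℤ) := (fun p : (Fin (m + 1) → ℤ) × (Fin (m + 1) → ℤ) =>
      p.1 0 • Fin.tail p.2 - p.2 0 • Fin.tail p.1) '' ({v ∈ L | 0 < v 0} ×ˢ {v ∈ L | v 0 < 0})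
    have hfin : (Z ∪ K).Finite := ((hL.sep _).image _).union (((hL.sep _).prod (hL.sep _)).image _)
    rcases ih (Z ∪ K) hfin with ⟨y, hy⟩ | h0
    · left
      have hsplit : ∀ (v : Fin (m + 1) → ℤ) (c : ℝ),
          ∑ i, (v i : ℝ) * (Fin.cons c y : Fin (m + 1) → ℝ) i
            = v 0 * c + ∑ i, (Fin.tail v i : ℝ) * y i := by
        intro v c
        rw [Fin.sum_univ_succ]
        simp [Fin.tail]
      -- The value φ v bounds the missing coordinate c from below if v 0 > 0 and from above if v 0 <
      -- 0; the vectors in K say that the lower bounds lie below the upper ones.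
      let φ : (Fin (m + 1) → ℤ) → ℝ := fun v => -(∑ i, (Fin.tail v i : ℝ) * y i) / v 0
      obtain ⟨c, hc1, hc2⟩ := exists_between_finite
        (A := φ '' {v ∈ L | 0 < v 0}) (B := φ '' {v ∈ L | v 0 < 0})
        ((hL.sep _).image _) ((hL.sep _).image _) (by
          rintro _ ⟨p, ⟨hp, hp0⟩, rfl⟩ _ ⟨q, ⟨hq, hq0⟩, rfl⟩
          have h1 := hy _ (Or.inr ⟨(p, q), ⟨⟨hp, hp0⟩, ⟨hq, hq0⟩⟩, rfl⟩)
          have hp0' : (0 : ℝ) < p 0 := by exact_mod_cast hp0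
          have hq0' : (0 : ℝ) < -(q 0 : ℝ) := by
            have : (q 0 : ℝ) < 0 := by exact_mod_cast hq0
            linarith
          have h2 : ∑ i, (((p 0 • Fin.tail q - q 0 • Fin.tail p) i : ℤ) : ℝ) * y i
              = p 0 * (∑ i, (Fin.tail q i : ℝ) * y i) - q 0 * ∑ i, (Fin.tail p i : ℝ) * y i := by
            rw [Finset.mul_sum, Finset.mul_sum, ← Finset.sum_sub_distrib]
            refine Finset.sum_congr rfl fun i _ => ?_
            simp
            ring
          rw [h2] at h1
          simp only [φ]
          rw [show -(∑ i, (Fin.tail q i : ℝ) * y i) / q 0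
            = (∑ i, (Fin.tail q i : ℝ) * y i) / (-q 0) by rw [div_neg, neg_div],
            div_lt_div_iff₀ hp0' hq0']
          linarith)
      refine ⟨Fin.cons c y, fun v hv => ?_⟩
      rw [hsplit]
      rcases lt_trichotomy (v 0) 0 with h | h | h
      · have h1 := hc2 _ ⟨v, ⟨hv, h⟩, rfl⟩
        have h2 : (v 0 : ℝ) < 0 := by exact_mod_cast h
        simp only [φ] at h1
        rw [lt_div_iff_of_neg h2] at h1
        linarith
      · have h1 := hy _ (Or.inl ⟨v, ⟨hv, h⟩, rfl⟩)
        rw [h]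
        simpa using h1
      · have h1 := hc1 _ ⟨v, ⟨hv, h⟩, rfl⟩
        have h2 : (0 : ℝ) < v 0 := by exact_mod_cast h
        simp only [φ] at h1
        rw [div_lt_iff₀ h2] at h1
        linarith
    · right
      have hsmul : ∀ (k : ℤ) (v : Fin (m + 1) → ℤ), 0 < k → v ∈ L →
          k • v ∈ AddSubsemigroup.closure L := by
        intro k v hk hv
        obtain ⟨j, rfl⟩ : ∃ j : ℕ, k = (j : ℤ) + 1 := ⟨(k - 1).toNat, by omega⟩
        clear hk
        induction j with
        | zero => simpa using AddSubsemigroup.subset_closure hv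
        | succ j ih =>
          rw [add_smul, one_smul]
          push_cast
          exact AddSubsemigroup.add_mem _ ih (AddSubsemigroup.subset_closure hv)
      have hlift : ∀ w ∈ AddSubsemigroup.closure (Z ∪ K),
          (Fin.cons 0 w : Fin (m + 1) → ℤ) ∈ AddSubsemigroup.closure L := by
        intro w hw
        induction hw using AddSubsemigroup.closure_induction with
        | mem w hw =>
          rcases hw with ⟨v, ⟨hv, h⟩, rfl⟩ | ⟨⟨p, q⟩, ⟨⟨hp, hp0⟩, ⟨hq, hq0⟩⟩, rfl⟩
          · rw [← h, Fin.cons_self_tail]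
            exact AddSubsemigroup.subset_closure hv
          · have : (Fin.cons 0 (p 0 • Fin.tail q - q 0 • Fin.tail p) : Fin (m + 1) → ℤ)
                = p 0 • q + (-q 0) • p := by
              ext i
              refine Fin.cases ?_ (fun i => ?_) i
              · simp
                ring
              · simp [Fin.tail]
                ring
            rw [this]
            exact AddSubsemigroup.add_mem _ (hsmul _ _ hp0 hq) (hsmul _ _ (by simpa using hq0) hp)
        | add v w _ _ hv hw =>
          have : (Fin.cons 0 (v + w) : Fin (m + 1) → ℤ) = Fin.cons 0 v + Fin.cons 0 w := by
            ext i
            refine Fin.cases ?_ (fun i => ?_) i <;> simp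
          rw [this]
          exact AddSubsemigroup.add_mem _ hv hw
      have := hlift 0 h0
      have h0' : (Fin.cons 0 0 : Fin (m + 1) → ℤ) = 0 := by
        ext i
        refine Fin.cases ?_ (fun i => ?_) i <;> simp
      rwa [h0'] at this

/-! ### Separating an upper set of positive roots by a dominant point -/

section Realize

variable {n : ℕ} {Pos F : Set (Fin n → ℤ)} {ht : (Fin n → ℤ) →+ ℤ}

theorem eq_zero_of_height_sum_nonpos (hht : ∀ β ∈ Pos, 0 < ht β) (M : Multiset (Fin n → ℤ))
    (hM : ∀ β ∈ M, β ∈ Pos) (h : ht M.sum ≤ 0) : M = 0 := by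
  have key : ∀ M : Multiset (Fin n → ℤ), (∀ β ∈ M, β ∈ Pos) → 0 ≤ ht M.sum := by
    intro M hM
    rw [map_multiset_sum]
    refine Multiset.sum_nonneg fun x hx => ?_
    obtain ⟨β, hβ, rfl⟩ := Multiset.mem_map.1 hx
    exact (hht β (hM β hβ)).le
  by_contra hne
  obtain ⟨β, hβ⟩ := Multiset.exists_mem_of_ne_zero hne
  obtain ⟨M', rfl⟩ := Multiset.exists_cons_of_mem hβ
  have h1 := key M' fun γ hγ => hM γ (Multiset.mem_cons_of_mem hγ)
  have h2 := hht β (hM β hβ)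
  rw [Multiset.sum_cons, map_add] at h
  omega

theorem exists_dotProduct_pos (S T : Multiset (Fin n → ℤ)) (h : 0 < S.sum ⬝ᵥ T.sum) :
    ∃ s ∈ S, ∃ t ∈ T, 0 < s ⬝ᵥ t := by
  by_contra! hcon
  have h1 : ∀ s ∈ S, s ⬝ᵥ T.sum ≤ 0 := by
    intro s hs
    refine Multiset.sum_induction (fun t => s ⬝ᵥ t ≤ 0) T ?_ (by simp) (hcon s hs)
    intro a b ha hb
    rw [dotProduct_add]
    omega
  have h2 : S.sum ⬝ᵥ T.sum ≤ 0 := by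
    refine Multiset.sum_induction (fun s => s ⬝ᵥ T.sum ≤ 0) S ?_ (by simp) h1
    intro a b ha hb
    rw [add_dotProduct]
    omega
  omega

/-- Induction on the total size. If G is nonempty, some γ in G has a positive product with some δ in
B or R, so γ = δ or one of their differences is a positive root. Either this contradicts that F is
closed upwards, or the relation can be shortened while keeping its form. -/
theorem multisets_eq_zero (hht : ∀ β ∈ Pos, 0 < ht β)
    (hD : ∀ β ∈ Pos, ∀ γ ∈ Pos, 0 < β ⬝ᵥ γ → β = γ ∨ β - γ ∈ Pos ∨ γ - β ∈ Pos)
    (hF : F ⊆ Pos) (hup : ∀ β ∈ F, ∀ γ ∈ Pos, γ - β ∈ Pos → γ ∈ F)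
    (B R G : Multiset (Fin n → ℤ)) (hB : ∀ β ∈ B, β ∈ F) (hR : ∀ ρ ∈ R, ρ ∈ Pos)
    (hG : ∀ γ ∈ G, γ ∈ Pos ∧ γ ∉ F) (hcard : G.card ≤ B.card) (hsum : B.sum + R.sum = G.sum) :
    B = 0 ∧ R = 0 ∧ G = 0 := by
  induction hN : B.card + R.card + G.card using Nat.strong_induction_on generalizing B R G with
  | _ N ih =>
  by_cases hG0 : G = 0
  · subst hG0
    have h0 : B + R = 0 := by
      refine eq_zero_of_height_sum_nonpos hht (B + R) ?_ ?_
      · intro β hβ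
        rcases Multiset.mem_add.1 hβ with h | h
        exacts [hF (hB β h), hR β h]
      · rw [Multiset.sum_add, hsum]
        simp
    rw [add_eq_zero] at h0
    exact ⟨h0.1, h0.2, rfl⟩
  · exfalso
    have hGne : G.sum ≠ 0 := by
      intro h
      refine hG0 (eq_zero_of_height_sum_nonpos hht G (fun γ hγ => (hG γ hγ).1) ?_)
      rw [h, map_zero]
    have hpos : 0 < G.sum ⬝ᵥ G.sum :=
      lt_of_le_of_ne (Finset.sum_nonneg fun i _ => mul_self_nonneg _)
        (Ne.symm (by simpa [dotProduct_self_eq_zero] using hGne))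
    -- Replacing one factor of ⟨∑G, ∑G⟩ > 0 by ∑B + ∑R produces the pair γ, δ with positive product.
    nth_rewrite 2 [← hsum] at hpos
    rw [← Multiset.sum_add] at hpos
    obtain ⟨γ, hγ, δ, hδ, hdot⟩ := exists_dotProduct_pos _ _ hpos
    obtain ⟨G', rfl⟩ := Multiset.exists_cons_of_mem hγ
    have hγ' := hG γ hγ
    have hG' : ∀ γ ∈ G', γ ∈ Pos ∧ γ ∉ F := fun x hx => hG x (Multiset.mem_cons_of_mem hx)
    simp only [Multiset.sum_cons, Multiset.card_cons] at hsum hcard hN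
    rcases Multiset.mem_add.1 hδ with hδ | hδ
    · obtain ⟨B', rfl⟩ := Multiset.exists_cons_of_mem hδ
      have hδF := hB δ hδ
      simp only [Multiset.sum_cons, Multiset.card_cons] at hsum hcard hN
      rcases hD γ hγ'.1 δ (hF hδF) hdot with h | h | h
      · exact hγ'.2 (h ▸ hδF)
      · exact hγ'.2 (hup δ hδF γ hγ'.1 h)
      -- The pair is replaced by δ - γ in R. The shorter relation would have to be empty, but it
      -- contains this root.
      · have := ih _ (by rw [Multiset.card_cons]; omega) B' ((δ - γ) ::ₘ R) G'
          (fun x hx => hB x (Multiset.mem_cons_of_mem hx))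
          (by
            intro x hx
            rcases Multiset.mem_cons.1 hx with rfl | hx
            exacts [h, hR x hx]) hG' (by omega)
          (by
            rw [Multiset.sum_cons, ← add_right_inj γ, ← hsum]
            abel) rfl
        exact Multiset.cons_ne_zero this.2.1
    · obtain ⟨R', rfl⟩ := Multiset.exists_cons_of_mem hδ
      have hδR := hR δ hδ
      have hR' : ∀ ρ ∈ R', ρ ∈ Pos := fun x hx => hR x (Multiset.mem_cons_of_mem hx)
      simp only [Multiset.sum_cons, Multiset.card_cons] at hsum hcard hN
      rcases hD γ hγ'.1 δ hδR hdot with h | h | h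
      · subst h
        have := ih _ (by omega) B R' G' hB hR' hG' (by omega)
          (by
            rw [← add_right_inj γ, ← hsum]
            abel) rfl
        rw [this.1] at hcard
        simp at hcard
      · have hnF : γ - δ ∉ F := fun hF' =>
          hγ'.2 (hup (γ - δ) hF' γ hγ'.1 (by rwa [sub_sub_cancel]))
        have := ih _ (by rw [Multiset.card_cons]; omega) B R' ((γ - δ) ::ₘ G') hB hR'
          (by
            intro x hx
            rcases Multiset.mem_cons.1 hx with rfl | hx
            exacts [⟨h, hnF⟩, hG' x hx]) (by rw [Multiset.card_cons]; omega)
          (by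
            rw [Multiset.sum_cons, ← add_right_inj δ]
            calc δ + (B.sum + R'.sum) = B.sum + (δ + R'.sum) := by abel
              _ = γ + G'.sum := hsum
              _ = δ + (γ - δ + G'.sum) := by abel) rfl
        exact Multiset.cons_ne_zero this.2.2
      · have := ih _ (by rw [Multiset.card_cons]; omega) B ((δ - γ) ::ₘ R') G' hB
          (by
            intro x hx
            rcases Multiset.mem_cons.1 hx with rfl | hx
            exacts [h, hR' x hx]) hG' (by omega)
          (by
            rw [Multiset.sum_cons, ← add_right_inj γ, ← hsum]
            abel) rfl
        exact Multiset.cons_ne_zero this.2.1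

theorem exists_separating_point (hfin : Pos.Finite) (hht : ∀ β ∈ Pos, 0 < ht β)
    (hD : ∀ β ∈ Pos, ∀ γ ∈ Pos, 0 < β ⬝ᵥ γ → β = γ ∨ β - γ ∈ Pos ∨ γ - β ∈ Pos)
    (hF : F ⊆ Pos) (hup : ∀ β ∈ F, ∀ γ ∈ Pos, γ - β ∈ Pos → γ ∈ F) :
    ∃ y : Fin n → ℝ, ∀ β ∈ Pos, 0 < ∑ i, (β i : ℝ) * y i ∧
      (β ∈ F → 1 < ∑ i, (β i : ℝ) * y i) ∧ (β ∉ F → ∑ i, (β i : ℝ) * y i < 1) := by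
  -- The threshold 1 is homogenized to a coordinate z 0: the vectors encode ⟨β, z⟩ > z 0 on F, ⟨γ,
  -- z⟩ < z 0 off F, positivity on `Pos`, and z 0 > 0.
  let L : Set (Fin (n + 1) → ℤ) :=
    (fun β => Fin.cons (-1) β) '' F ∪ (fun γ => Fin.cons 1 (-γ)) '' (Pos \ F) ∪
      (fun ρ => Fin.cons 0 ρ) '' Pos ∪ {Fin.cons 1 0}
  have hL : L.Finite := ((((hfin.subset hF).image _).union ((hfin.subset Set.sdiff_subset).image _)).union
    (hfin.image _)).union (Set.finite_singleton _)
  rcases gordan (n + 1) L hL with ⟨z, hz⟩ | h0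
  · have hsplit : ∀ (c : ℤ) (v : Fin n → ℤ),
        ∑ i, ((Fin.cons c v : Fin (n + 1) → ℤ) i : ℝ) * z i
          = c * z 0 + ∑ i, (v i : ℝ) * z i.succ := by
      intro c v
      rw [Fin.sum_univ_succ]
      simp
    have ht0 : 0 < z 0 := by
      have := hz _ (Or.inr rfl)
      rw [hsplit] at this
      simpa using this
    have hdiv : ∀ v : Fin n → ℤ, ∑ i, (v i : ℝ) * (z i.succ / z 0)
        = (∑ i, (v i : ℝ) * z i.succ) / z 0 := by
      intro v
      rw [Finset.sum_div]
      exact Finset.sum_congr rfl fun i _ => by ring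
    refine ⟨fun i => z i.succ / z 0, fun β hβ => ?_⟩
    rw [hdiv]
    refine ⟨?_, fun h => ?_, fun h => ?_⟩
    · have := hz _ (Or.inl (Or.inr ⟨β, hβ, rfl⟩))
      rw [hsplit] at this
      exact div_pos (by simpa using this) ht0
    · have := hz _ (Or.inl (Or.inl (Or.inl ⟨β, h, rfl⟩)))
      rw [hsplit] at this
      rw [lt_div_iff₀ ht0]
      push_cast at this
      linarith
    · have := hz _ (Or.inl (Or.inl (Or.inr ⟨β, ⟨hβ, h⟩, rfl⟩)))
      rw [hsplit] at this
      rw [div_lt_iff₀ ht0]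
      simp at this
      linarith
  · exfalso
    -- The multisets and e record how often each kind of vector occurs. For v = 0 the first
    -- coordinate gives |B| = |G| + e, hence |G| ≤ |B|.
    have key : ∀ v ∈ AddSubsemigroup.closure L, ∃ (B R G : Multiset (Fin n → ℤ)) (e : ℕ),
        (∀ β ∈ B, β ∈ F) ∧ (∀ ρ ∈ R, ρ ∈ Pos) ∧ (∀ γ ∈ G, γ ∈ Pos ∧ γ ∉ F) ∧
        0 < B.card + R.card + G.card + e ∧ v 0 = -(B.card : ℤ) + G.card + e ∧
        Fin.tail v = B.sum + R.sum - G.sum := by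
      intro v hv
      induction hv using AddSubsemigroup.closure_induction with
      | mem v hv =>
        rcases hv with ((⟨β, h, rfl⟩ | ⟨γ, h, rfl⟩) | ⟨ρ, h, rfl⟩) | h
        · exact ⟨{β}, 0, 0, 0, by simpa, by simp, by simp, by simp, by simp, by simp⟩
        · exact ⟨0, 0, {γ}, 0, by simp, by simp, by simpa using h, by simp, by simp, by simp⟩
        · exact ⟨0, {ρ}, 0, 0, by simp, by simpa, by simp, by simp, by simp, by simp⟩
        · rw [Set.mem_singleton_iff] at h
          subst h
          exact ⟨0, 0, 0, 1, by simp, by simp, by simp, by simp, by simp, by simp⟩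
      | add v w _ _ hv hw =>
        obtain ⟨B, R, G, e, h1, h2, h3, h4, h5, h6⟩ := hv
        obtain ⟨B', R', G', e', h1', h2', h3', h4', h5', h6'⟩ := hw
        refine ⟨B + B', R + R', G + G', e + e', ?_, ?_, ?_, ?_, ?_, ?_⟩
        · intro x hx
          exact (Multiset.mem_add.1 hx).elim (h1 x) (h1' x)
        · intro x hx
          exact (Multiset.mem_add.1 hx).elim (h2 x) (h2' x)
        · intro x hx
          exact (Multiset.mem_add.1 hx).elim (h3 x) (h3' x)
        · simp only [Multiset.card_add]
          omega
        · simp only [Multiset.card_add, Pi.add_apply, h5, h5']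
          push_cast
          ring
        · have : Fin.tail (v + w) = Fin.tail v + Fin.tail w := rfl
          rw [this, h6, h6']
          simp only [Multiset.sum_add]
          abel
    obtain ⟨B, R, G, e, h1, h2, h3, h4, h5, h6⟩ := key 0 h0
    simp only [Pi.zero_apply] at h5
    have h6' : B.sum + R.sum = G.sum := by
      rw [← sub_eq_zero, ← h6]
      rfl
    obtain ⟨rfl, rfl, rfl⟩ := multisets_eq_zero hht hD hF hup B R G h1 h2 h3 (by omega) h6'
    simp at h4 h5
    omega

end Realize

/-! ### Integer root vectors -/

/-- The integer vector `e_k`, for `1 ≤ k ≤ n`. -/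
def intVec (n k : ℕ) : Fin n → ℤ := fun i => if (i : ℕ) + 1 = k then 1 else 0

/-- The value at the root with the index `t` of the linear form with the values `g k` at `e_k`. -/
def RootIndex.eval {n : ℕ} {R : Type*} [AddGroup R] (t : RootIndex n) (g : ℕ → R) : R :=
  g t.a + if t.b ≤ n then -g t.b else g (2 * n + 1 - t.b)

/-- The root with the index `t`, as an integer vector. -/
def rootVec {n : ℕ} (t : RootIndex n) : Fin n → ℤ := t.eval (intVec n)

theorem sum_intVec_mul {R : Type*} [CommRing R] {n k : ℕ} (hk : 1 ≤ k) (hkn : k ≤ n) (g : ℕ → R) :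
    ∑ i : Fin n, (intVec n k i : R) * g (i + 1) = g k := by
  rw [Finset.sum_eq_single (⟨k - 1, by omega⟩ : Fin n)]
  · simp [intVec, Nat.sub_add_cancel hk]
  · intro i _ hi
    have : (i : ℕ) + 1 ≠ k := by
      intro h
      apply hi
      ext
      simp
      omega
    simp [intVec, this]
  · simp

theorem sum_rootVec_mul {R : Type*} [CommRing R] {n : ℕ} {t : RootIndex n} (ht : t ∈ rootIndices n)
    (g : ℕ → R) : ∑ i : Fin n, (rootVec t i : R) * g (i + 1) = t.eval g := by
  rw [mem_rootIndices] at ht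
  unfold rootVec RootIndex.eval
  split_ifs with h
  · simp only [Pi.add_apply, Pi.neg_apply, Int.cast_add, Int.cast_neg, add_mul, neg_mul,
      Finset.sum_add_distrib, Finset.sum_neg_distrib]
    rw [sum_intVec_mul (by omega) (by omega), sum_intVec_mul (by omega) (by omega)]
  · simp only [Pi.add_apply, Int.cast_add, add_mul, Finset.sum_add_distrib]
    rw [sum_intVec_mul (by omega) (by omega), sum_intVec_mul (by omega) (by omega)]

theorem rootVec_dotProduct_self {n : ℕ} {t : RootIndex n} (ht : t ∈ rootIndices n) :
    rootVec t ⬝ᵥ rootVec t = 2 := by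
  have h := sum_rootVec_mul (R := ℤ) ht (fun k => t.eval (fun j => if k = j then (1 : ℤ) else 0))
  have h1 : ∀ i : Fin n, t.eval (fun j => if (i : ℕ) + 1 = j then (1 : ℤ) else 0) = rootVec t i := by
    intro i
    unfold rootVec RootIndex.eval
    split_ifs <;> simp [intVec]
  rw [mem_rootIndices] at ht
  simp only [h1, Int.cast_id] at h
  rw [dotProduct, h]
  simp only [RootIndex.eval]
  split_ifs <;> omega

/-- The height function `∑ (n - i) x_i`. -/
def height (n : ℕ) : (Fin n → ℤ) →+ ℤ where
  toFun v := ∑ i, v i * ((n : ℤ) - ((i + 1 : ℕ) : ℤ))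
  map_zero' := by simp
  map_add' v w := by simp [add_mul, Finset.sum_add_distrib]

theorem height_rootVec_pos {n : ℕ} {t : RootIndex n} (ht : t ∈ rootIndices n) :
    0 < height n (rootVec t) := by
  have h := sum_rootVec_mul (R := ℤ) ht (fun k => (n : ℤ) - (k : ℤ))
  simp only [Int.cast_id] at h
  change 0 < ∑ i, rootVec t i * ((n : ℤ) - ((i + 1 : ℕ) : ℤ))
  rw [h]
  rw [mem_rootIndices] at ht
  simp only [RootIndex.eval]
  split_ifs <;> omega

/-- Integer squares with sum 2 leave exactly two entries, both ±1. Roots are thus the integer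
vectors of squared length 2, which yields both the difference property and Weyl invariance. -/
theorem exists_rootVec_of_dotProduct_self {n : ℕ} {v : Fin n → ℤ} (hv : v ⬝ᵥ v = 2) :
    ∃ t ∈ rootIndices n, v = rootVec t ∨ v = -rootVec t := by
  have hle : ∀ i, v i * v i ≤ 2 := fun i => by
    rw [← hv]
    exact Finset.single_le_sum (f := fun i => v i * v i) (fun j _ => mul_self_nonneg (v j))
      (Finset.mem_univ i)
  have hpm : ∀ i, v i = 0 ∨ v i = 1 ∨ v i = -1 := by
    intro i
    have h1 : -1 ≤ v i := by nlinarith [hle i]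
    have h2 : v i ≤ 1 := by nlinarith [hle i]
    omega
  have hcard : (Finset.univ.filter fun i => v i ≠ 0).card = 2 := by
    have : v ⬝ᵥ v = ∑ i, if v i ≠ 0 then (1 : ℤ) else 0 := by
      refine Finset.sum_congr rfl fun i _ => ?_
      rcases hpm i with h | h | h <;> simp [h]
    rw [this, Finset.sum_boole] at hv
    exact_mod_cast hv
  obtain ⟨i, j, hij, hS⟩ := Finset.card_eq_two.1 hcard
  wlog hlt : i < j generalizing i j
  · exact this j i hij.symm (by rw [hS, Finset.pair_comm]) (by omega)
  have hsupp : ∀ k, v k ≠ 0 ↔ k = i ∨ k = j := by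
    intro k
    have : k ∈ Finset.univ.filter (fun i => v i ≠ 0) ↔ k ∈ ({i, j} : Finset (Fin n)) := by rw [hS]
    simpa using this
  have hi := (hpm i).resolve_left ((hsupp i).2 (Or.inl rfl))
  have hj := (hpm j).resolve_left ((hsupp j).2 (Or.inr rfl))
  have h0 : ∀ k, k ≠ i → k ≠ j → v k = 0 := by
    intro k h1 h2
    by_contra h
    exact ((hsupp k).1 h).elim h1 h2
  have hlt' : (i : ℕ) < j := hlt
  have hjn := j.2
  have main : ∀ t : RootIndex n, ∀ s : ℤ, (∀ k, k ≠ i → k ≠ j → rootVec t k = 0) →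
      v i = s * rootVec t i → v j = s * rootVec t j → v = s • rootVec t := by
    intro t s h1 h2 h3
    ext k
    by_cases hki : k = i
    · simpa [hki] using h2
    by_cases hkj : k = j
    · simpa [hkj] using h3
    simp [h0 k hki hkj, h1 k hki hkj]
  have hval : ∀ k, rootVec (n := n) ⟨i + 1, j + 1⟩ k
      = (if k = i then 1 else 0) + (if k = j then -1 else 0) := by
    intro k
    simp only [rootVec, RootIndex.eval, if_pos (show (j : ℕ) + 1 ≤ n by omega), Pi.add_apply,
      Pi.neg_apply, intVec, Fin.ext_iff]
    split_ifs <;> omega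
  have hval' : ∀ k, rootVec (n := n) ⟨i + 1, 2 * n - j⟩ k
      = (if k = i then 1 else 0) + (if k = j then 1 else 0) := by
    intro k
    simp only [rootVec, RootIndex.eval, if_neg (show ¬ 2 * n - (j : ℕ) ≤ n by omega), Pi.add_apply,
      intVec, Fin.ext_iff]
    split_ifs <;> omega
  have hmem : (⟨i + 1, j + 1⟩ : RootIndex n) ∈ rootIndices n := by
    rw [mem_rootIndices]
    dsimp only
    omega
  have hmem' : (⟨i + 1, 2 * n - j⟩ : RootIndex n) ∈ rootIndices n := by
    rw [mem_rootIndices]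
    dsimp only
    omega
  have hz : ∀ k, k ≠ i → k ≠ j → rootVec (n := n) ⟨i + 1, j + 1⟩ k = 0 := by
    intro k h1 h2
    simp [hval, h1, h2]
  have hz' : ∀ k, k ≠ i → k ≠ j → rootVec (n := n) ⟨i + 1, 2 * n - j⟩ k = 0 := by
    intro k h1 h2
    simp [hval', h1, h2]
  rcases hi with hi | hi <;> rcases hj with hj | hj
  · refine ⟨_, hmem', Or.inl ?_⟩
    simpa using main _ 1 hz' (by simp [hval', hi, hij]) (by simp [hval', hj, hij.symm])
  · refine ⟨_, hmem, Or.inl ?_⟩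
    simpa using main _ 1 hz (by simp [hval, hi, hij]) (by simp [hval, hj, hij.symm])
  · refine ⟨_, hmem, Or.inr ?_⟩
    simpa using main _ (-1) hz (by simp [hval, hi, hij]) (by simp [hval, hj, hij.symm])
  · refine ⟨_, hmem', Or.inr ?_⟩
    simpa using main _ (-1) hz' (by simp [hval', hi, hij]) (by simp [hval', hj, hij.symm])

/-- The difference has squared length 4 - 2⟨p, q⟩, which is nonnegative, even and below 4, hence 0
or 2. -/
theorem rootVec_pos_or {n : ℕ} {p q : RootIndex n} (hp : p ∈ rootIndices n)
    (hq : q ∈ rootIndices n) (h : 0 < rootVec p ⬝ᵥ rootVec q) :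
    rootVec p = rootVec q ∨ rootVec p - rootVec q ∈ rootVec '' (rootIndices n : Set (RootIndex n)) ∨
      rootVec q - rootVec p ∈ rootVec '' (rootIndices n : Set (RootIndex n)) := by
  have h1 : (rootVec p - rootVec q) ⬝ᵥ (rootVec p - rootVec q) = 4 - 2 * rootVec p ⬝ᵥ rootVec q := by
    rw [sub_dotProduct, dotProduct_sub, dotProduct_sub, rootVec_dotProduct_self hp,
      rootVec_dotProduct_self hq, dotProduct_comm (rootVec q)]
    ring
  have h0 : 0 ≤ (rootVec p - rootVec q) ⬝ᵥ (rootVec p - rootVec q) :=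
    Finset.sum_nonneg fun i _ => mul_self_nonneg _
  obtain h2 | h2 : (rootVec p - rootVec q) ⬝ᵥ (rootVec p - rootVec q) = 0 ∨
      (rootVec p - rootVec q) ⬝ᵥ (rootVec p - rootVec q) = 2 := by omega
  · rw [dotProduct_self_eq_zero] at h2
    exact Or.inl (sub_eq_zero.1 h2)
  · obtain ⟨t, ht, h3 | h3⟩ := exists_rootVec_of_dotProduct_self h2
    · exact Or.inr (Or.inl ⟨t, ht, h3.symm⟩)
    · refine Or.inr (Or.inr ⟨t, ht, ?_⟩)
      rw [← neg_sub, h3, neg_neg]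

/-- The test forms are nonnegative on positive roots: partial coordinate sums, the full sum, and the
sum with the last sign changed. The last form excludes the pair b = n, b = n + 1. -/
theorem RootIndex.le_of_eval_le {n : ℕ} {p q : RootIndex n} (hp : p ∈ rootIndices n)
    (hq : q ∈ rootIndices n)
    (h2 : ∀ k ≤ n - 1, p.eval (fun j => if j ≤ k then (1 : ℤ) else 0)
      ≤ q.eval (fun j => if j ≤ k then (1 : ℤ) else 0))
    (h3 : p.eval (fun _ => (1 : ℤ)) ≤ q.eval (fun _ => (1 : ℤ)))
    (h4 : p.eval (fun j => if j ≤ n - 1 then (1 : ℤ) else -1)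
      ≤ q.eval (fun j => if j ≤ n - 1 then (1 : ℤ) else -1)) : p ≤ q := by
  rw [mem_rootIndices] at hp hq
  have ha : q.a ≤ p.a := by
    by_contra hcon
    have := h2 p.a (by omega)
    simp only [RootIndex.eval] at this
    split_ifs at this <;> omega
  have hb : p.b ≤ q.b := by
    by_contra hcon
    have h5 := h2 (n - 1) le_rfl
    by_cases hpn : p.b ≤ n
    · have h6 := h2 (max q.b p.a) (by omega)
      simp only [RootIndex.eval] at h6
      split_ifs at h6 <;> omega
    · by_cases hqn : n + 2 ≤ q.b
      · have h6 := h2 (2 * n + 1 - p.b) (by omega)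
        simp only [RootIndex.eval] at h6
        split_ifs at h6 <;> omega
      · simp only [RootIndex.eval] at h3 h5
        split_ifs at h3 h5 <;> omega
  refine ⟨ha, hb, ?_⟩
  rintro ⟨h6, h7⟩
  simp only [RootIndex.eval] at h4
  split_ifs at h4 <;> omega

theorem le_of_rootVec_sub {n : ℕ} {p q r : RootIndex n} (hp : p ∈ rootIndices n)
    (hq : q ∈ rootIndices n) (hr : r ∈ rootIndices n) (h : rootVec q - rootVec p = rootVec r) :
    p ≤ q := by
  have h1 : ∀ g : ℕ → ℤ, q.eval g = p.eval g + r.eval g := by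
    intro g
    rw [← sum_rootVec_mul hp, ← sum_rootVec_mul hq, ← sum_rootVec_mul hr,
      ← Finset.sum_add_distrib]
    refine Finset.sum_congr rfl fun i _ => ?_
    rw [← h]
    simp
    ring
  refine RootIndex.le_of_eval_le hp hq ?_ ?_ ?_
  all_goals
    rw [mem_rootIndices] at hr
    try intro k hk
    rw [h1]
    simp only [RootIndex.eval]
    split_ifs <;> omega

theorem rootVec_injOn {n : ℕ} : Set.InjOn (rootVec (n := n)) (rootIndices n) := by
  intro p hp q hq h
  have h1 : ∀ g : ℕ → ℤ, p.eval g = q.eval g := by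
    intro g
    rw [← sum_rootVec_mul hp, ← sum_rootVec_mul hq, h]
  exact le_antisymm
    (RootIndex.le_of_eval_le hp hq (fun k _ => (h1 _).le) (h1 _).le (h1 _).le)
    (RootIndex.le_of_eval_le hq hp (fun k _ => (h1 _).ge) (h1 _).ge (h1 _).ge)

/-- Every upper set of positive roots is cut out of the positive roots by a dominant point. -/
theorem exists_dominant_point {n : ℕ} (F : Set (RootIndex n))
    (hup : ∀ p ∈ F, ∀ q ∈ rootIndices n, p ≤ q → q ∈ F) (hF : F ⊆ rootIndices n) :
    ∃ y : Fin n → ℝ, ∀ t ∈ rootIndices n, 0 < ∑ i, (rootVec t i : ℝ) * y i ∧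
      (t ∈ F → 1 < ∑ i, (rootVec t i : ℝ) * y i) ∧ (t ∉ F → ∑ i, (rootVec t i : ℝ) * y i < 1) := by
  have hF' : ∀ t ∈ rootIndices n, rootVec t ∈ rootVec '' F → t ∈ F := by
    rintro t ht ⟨p, hp, hpt⟩
    exact rootVec_injOn (hF hp) ht hpt ▸ hp
  obtain ⟨y, hy⟩ := exists_separating_point (Pos := rootVec '' (rootIndices n : Set (RootIndex n)))
    (F := rootVec '' F) (ht := height n) ((rootIndices n).finite_toSet.image _)
    (by
      rintro _ ⟨t, ht, rfl⟩
      exact height_rootVec_pos ht)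
    (by
      rintro _ ⟨p, hp, rfl⟩ _ ⟨q, hq, rfl⟩ h
      exact rootVec_pos_or hp hq h)
    (Set.image_mono hF)
    (by
      rintro _ ⟨p, hp, rfl⟩ _ ⟨q, hq, rfl⟩ ⟨r, hr, h⟩
      exact ⟨q, hup p hp q hq (le_of_rootVec_sub (hF hp) hq hr h.symm), rfl⟩)
  refine ⟨y, fun t ht => ?_⟩
  obtain ⟨h1, h2, h3⟩ := hy (rootVec t) ⟨t, ht, rfl⟩
  exact ⟨h1, fun h => h2 ⟨t, h, rfl⟩, fun h => h3 fun h' => h (hF' t ht h')⟩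

/-! ### Roots as points of Euclidean space -/

/-- An integer vector as a point of Euclidean space. -/
noncomputable def ofInt {n : ℕ} (z : Fin n → ℤ) : E n := WithLp.toLp 2 fun i => (z i : ℝ)

@[simp] theorem ofInt_apply {n : ℕ} (z : Fin n → ℤ) (i : Fin n) : ofInt z i = z i := rfl

theorem ofInt_add {n : ℕ} (z z' : Fin n → ℤ) : ofInt (z + z') = ofInt z + ofInt z' := by
  ext i
  simp

theorem ofInt_neg {n : ℕ} (z : Fin n → ℤ) : ofInt (-z) = -ofInt z := by
  ext i
  simp

theorem inner_ofInt {n : ℕ} (z : Fin n → ℤ) (y : E n) : ⟪ofInt z, y⟫ = ∑ i, (z i : ℝ) * y i := by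
  simp [PiLp.inner_apply, mul_comm]

theorem inner_ofInt_ofInt {n : ℕ} (z z' : Fin n → ℤ) :
    ⟪ofInt z, ofInt z'⟫ = ((z ⬝ᵥ z' : ℤ) : ℝ) := by
  rw [inner_ofInt, dotProduct]
  push_cast
  rfl

theorem ofInt_injective {n : ℕ} : Function.Injective (ofInt (n := n)) := by
  intro z z' h
  ext i
  have := congrArg (fun v : E n => v i) h
  simpa using this

theorem basisVec_eq {n : ℕ} (i : Fin n) : basisVec n i = ofInt (intVec n (i + 1)) := by
  ext j
  simp only [basisVec, PiLp.single_apply, ofInt_apply, intVec, Fin.ext_iff]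
  split_ifs <;> simp <;> omega

theorem mem_posRoots {n : ℕ} {v : E n} :
    v ∈ posRoots n ↔ ∃ t ∈ rootIndices n, v = ofInt (rootVec t) := by
  constructor
  · rintro ⟨i, j, hij, h⟩
    have hij' : (i : ℕ) < j := hij
    have hj := j.2
    rcases h with rfl | rfl
    · refine ⟨⟨i + 1, j + 1⟩, ?_, ?_⟩
      · rw [mem_rootIndices]
        dsimp only
        omega
      · rw [rootVec, RootIndex.eval, if_pos (show (j : ℕ) + 1 ≤ n by omega), ofInt_add, ofInt_neg,
          basisVec_eq, basisVec_eq, sub_eq_add_neg]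
    · refine ⟨⟨i + 1, 2 * n - j⟩, ?_, ?_⟩
      · rw [mem_rootIndices]
        dsimp only
        omega
      · rw [rootVec, RootIndex.eval, if_neg (show ¬ 2 * n - (j : ℕ) ≤ n by omega), ofInt_add,
          basisVec_eq, basisVec_eq, show 2 * n + 1 - (2 * n - (j : ℕ)) = j + 1 by omega]
  · rintro ⟨⟨a, b⟩, ht, rfl⟩
    rw [mem_rootIndices] at ht
    dsimp only at ht
    by_cases hb : b ≤ n
    · refine ⟨⟨a - 1, by omega⟩, ⟨b - 1, by omega⟩, by simp; omega, Or.inl ?_⟩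
      rw [rootVec, RootIndex.eval, if_pos hb, ofInt_add, ofInt_neg, basisVec_eq, basisVec_eq,
        sub_eq_add_neg, Nat.sub_add_cancel (by omega), Nat.sub_add_cancel (by omega)]
    · refine ⟨⟨a - 1, by omega⟩, ⟨2 * n - b, by omega⟩, by simp; omega, Or.inr ?_⟩
      rw [rootVec, RootIndex.eval, if_neg hb, ofInt_add, basisVec_eq, basisVec_eq,
        Nat.sub_add_cancel (by omega), show 2 * n - b + 1 = 2 * n + 1 - b by omega]

theorem mem_roots {n : ℕ} {v : E n} : v ∈ roots n ↔ ∃ z, z ⬝ᵥ z = 2 ∧ v = ofInt z := by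
  simp only [roots, negRoots, Set.mem_union, Set.mem_ofPred_eq, mem_posRoots]
  constructor
  · rintro (⟨t, ht, rfl⟩ | ⟨t, ht, h⟩)
    · exact ⟨_, rootVec_dotProduct_self ht, rfl⟩
    · refine ⟨-rootVec t, ?_, ?_⟩
      · rw [neg_dotProduct_neg, rootVec_dotProduct_self ht]
      · rw [ofInt_neg, ← h, neg_neg]
  · rintro ⟨z, hz, rfl⟩
    obtain ⟨t, ht, rfl | rfl⟩ := exists_rootVec_of_dotProduct_self hz
    · exact Or.inl ⟨t, ht, rfl⟩
    · exact Or.inr ⟨t, ht, by rw [ofInt_neg, neg_neg]⟩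

/-! ### The Weyl group permutes the roots -/

theorem reflection_ofInt {n : ℕ} {α : E n} (hα : α ∈ roots n) (z : Fin n → ℤ) :
    ∃ z', (Submodule.span ℝ {α})ᗮ.reflection (ofInt z) = ofInt z' := by
  obtain ⟨a, ha, rfl⟩ := mem_roots.1 hα
  refine ⟨z - (a ⬝ᵥ z) • a, ?_⟩
  have hnorm : ‖ofInt a‖ ^ 2 = 2 := by
    rw [← real_inner_self_eq_norm_sq, inner_ofInt_ofInt, ha]
    norm_num
  rw [Submodule.reflection_orthogonal_apply, Submodule.reflection_singleton_apply, inner_ofInt_ofInt]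
  ext i
  simp [hnorm]
  ring

/-- Integrality of the inverse is carried along so that the inversion step of the closure induction
goes through. -/
theorem weylGroup_ofInt {n : ℕ} {g : E n ≃ₗᵢ[ℝ] E n} (hg : g ∈ weylGroup n) :
    (∀ z, ∃ z', g (ofInt z) = ofInt z') ∧ ∀ z, ∃ z', g⁻¹ (ofInt z) = ofInt z' := by
  induction hg using Subgroup.closure_induction with
  | mem s hs =>
    obtain ⟨α, hα, rfl⟩ := hs
    refine ⟨reflection_ofInt hα, fun z => ?_⟩
    rw [Submodule.reflection_inv]
    exact reflection_ofInt hα z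
  | one => exact ⟨fun z => ⟨z, rfl⟩, fun z => ⟨z, by simp⟩⟩
  | mul g h _ _ hg hh =>
    refine ⟨fun z => ?_, fun z => ?_⟩
    · obtain ⟨z', h1⟩ := hh.1 z
      obtain ⟨z'', h2⟩ := hg.1 z'
      exact ⟨z'', by rw [LinearIsometryEquiv.coe_mul, Function.comp_apply, h1, h2]⟩
    · obtain ⟨z', h1⟩ := hg.2 z
      obtain ⟨z'', h2⟩ := hh.2 z'
      exact ⟨z'', by rw [mul_inv_rev, LinearIsometryEquiv.coe_mul, Function.comp_apply, h1, h2]⟩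
  | inv g _ hg => exact ⟨hg.2, by rw [inv_inv]; exact hg.1⟩

/-- An isometry that preserves integrality preserves the integer vectors of squared length 2. -/
theorem weylGroup_map_roots {n : ℕ} {g : E n ≃ₗᵢ[ℝ] E n} (hg : g ∈ weylGroup n) {v : E n}
    (hv : v ∈ roots n) : g v ∈ roots n := by
  obtain ⟨z, hz, rfl⟩ := mem_roots.1 hv
  obtain ⟨z', h⟩ := (weylGroup_ofInt hg).1 z
  rw [mem_roots]
  refine ⟨z', ?_, h⟩
  have h1 : ⟪g (ofInt z), g (ofInt z)⟫ = ⟪ofInt z, ofInt z⟫ := g.inner_map_map _ _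
  rw [h, inner_ofInt_ofInt, inner_ofInt_ofInt, hz] at h1
  exact_mod_cast h1

/-! ### Dominant points respect the root order -/

theorem inner_le_of_le {n : ℕ} {y : E n} (hy : y ∈ dominantCone n) {t s : RootIndex n}
    (ht : t ∈ rootIndices n) (hs : s ∈ rootIndices n) (hts : t ≤ s) :
    ⟪ofInt (rootVec t), y⟫ ≤ ⟪ofInt (rootVec s), y⟫ := by
  let g : ℕ → ℝ := fun k => if h : 1 ≤ k ∧ k ≤ n then y ⟨k - 1, by omega⟩ else 0
  have hg : ∀ t ∈ rootIndices n, ⟪ofInt (rootVec t), y⟫ = t.eval g := by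
    intro t ht
    rw [inner_ofInt, ← sum_rootVec_mul ht]
    refine Finset.sum_congr rfl fun i _ => ?_
    have : 1 ≤ (i : ℕ) + 1 ∧ (i : ℕ) + 1 ≤ n := ⟨by omega, i.2⟩
    simp only [g, dif_pos this]
    rfl
  have hpos : ∀ t ∈ rootIndices n, 0 < t.eval g := by
    intro t ht
    rw [← hg t ht]
    exact hy _ (mem_posRoots.2 ⟨t, ht, rfl⟩)
  have hminus : ∀ i j, 1 ≤ i → i ≤ j → j ≤ n → g j ≤ g i := by
    intro i j h1 h2 h3
    rcases h2.eq_or_lt with rfl | h2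
    · exact le_rfl
    · have := hpos ⟨i, j⟩ (by rw [mem_rootIndices]; dsimp only; omega)
      simp only [RootIndex.eval, if_pos h3] at this
      linarith
  have hplus : ∀ i j, 1 ≤ i → i < j → j ≤ n → 0 < g i + g j := by
    intro i j h1 h2 h3
    have := hpos ⟨i, 2 * n + 1 - j⟩ (by rw [mem_rootIndices]; dsimp only; omega)
    simp only [RootIndex.eval] at this
    rwa [if_neg (by omega), show 2 * n + 1 - (2 * n + 1 - j) = j by omega] at this
  rw [hg t ht, hg s hs]
  rw [mem_rootIndices] at ht hs
  obtain ⟨h1, h2, h3⟩ := hts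
  unfold RootIndex.eval
  refine add_le_add (hminus _ _ (by omega) h1 (by omega)) ?_
  by_cases hb : t.b ≤ n
  · by_cases hb' : s.b ≤ n
    · rw [if_pos hb, if_pos hb', neg_le_neg_iff]
      exact hminus _ _ (by omega) h2 hb'
    · rw [if_pos hb, if_neg hb']
      rcases lt_trichotomy t.b (2 * n + 1 - s.b) with h | h | h
      · have := hplus _ _ (by omega) h (by omega)
        linarith
      -- Both roots involve the same coordinate t.b. The pair (n, n + 1) is excluded by the order,
      -- so t.b < n and the n-th coordinate can be used as a comparison.
      · have h4 := hplus t.b n (by omega) (by omega) le_rfl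
        have h5 := hminus t.b n (by omega) (by omega) le_rfl
        rw [← h]
        linarith
      · have := hplus _ _ (by omega) h (by omega)
        linarith
  · rw [if_neg hb, if_neg (by omega)]
    exact hminus _ _ (by omega) (by omega) (by omega)

/-! ### The labels of the corners -/

theorem eVec_eq (n k : ℕ) : eVec n k = ofInt (intVec n k) := by
  ext i
  simp [eVec, intVec]

theorem rootSum_eq {n i j : ℕ} (hij : i ≤ j + 1) (hj : j ≤ n - 1) (hn : 1 ≤ n) :
    rootSum n i j = eVec n i - eVec n (j + 1) := by
  induction j with
  | zero =>
    rcases Nat.le_one_iff_eq_zero_or_eq_one.1 hij with rfl | rfl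
    · simp only [rootSum, Finset.Icc_self, Finset.sum_singleton, simpleRoot]
      rw [if_neg (by omega)]
    · simp [rootSum]
  | succ j ih =>
    rcases hij.eq_or_lt with rfl | hlt
    · simp [rootSum]
    · rw [rootSum, Finset.sum_Icc_succ_top (by omega)]
      have := ih (by omega) (by omega)
      rw [rootSum] at this
      rw [this, simpleRoot, if_neg (by omega)]
      abel

theorem rootSum_top_eq {n i : ℕ} (hi : i ≤ n) (hn : 1 ≤ n) :
    rootSum n i n = eVec n i + eVec n (n - 1) := by
  obtain ⟨m, rfl⟩ : ∃ m, n = m + 1 := ⟨n - 1, by omega⟩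
  have h := rootSum_eq (n := m + 1) (i := i) (j := m) hi (by omega) hn
  rw [rootSum] at h ⊢
  rw [Finset.sum_Icc_succ_top (by omega), h, simpleRoot, if_pos rfl]
  abel

/-- The sums of simple roots telescope, so the four families of corners become arithmetic conditions
together with a single label. -/
theorem isCorner_iff {n : ℕ} (hn : 3 ≤ n) {α : E n} {P : Vertex} :
    IsCorner n α P ↔ IsBox n P ∧ α = ofInt (rootVec (boxLabel n P)) := by
  have e1 : ∀ i j, 1 ≤ i → i ≤ j → j ≤ n - 1 →
      rootSum n i j = ofInt (rootVec (n := n) ⟨i, j + 1⟩) := by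
    intro i j h1 h2 h3
    rw [rootSum_eq (by omega) h3 (by omega), rootVec, RootIndex.eval,
      if_pos (show j + 1 ≤ n by omega), ofInt_add, ofInt_neg, eVec_eq, eVec_eq, sub_eq_add_neg]
  have e3 : ∀ i, 1 ≤ i → i ≤ n - 1 →
      rootSum n i (n - 2) + simpleRoot n n = ofInt (rootVec (n := n) ⟨i, n + 1⟩) := by
    intro i h1 h2
    rw [rootSum_eq (by omega) (by omega) (by omega), simpleRoot, if_pos rfl, rootVec,
      RootIndex.eval, if_neg (show ¬ n + 1 ≤ n by omega), ofInt_add, ← eVec_eq, ← eVec_eq,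
      show n - 2 + 1 = n - 1 by omega, show 2 * n + 1 - (n + 1) = n by omega]
    abel
  have e4 : ∀ i k, 1 ≤ i → i < k → k ≤ n - 1 →
      rootSum n i n + rootSum n k (n - 2) = ofInt (rootVec (n := n) ⟨i, 2 * n + 1 - k⟩) := by
    intro i k h1 h2 h3
    rw [rootSum_top_eq (by omega) (by omega), rootSum_eq (by omega) (by omega) (by omega), rootVec,
      RootIndex.eval, if_neg (show ¬ 2 * n + 1 - k ≤ n by omega), ofInt_add, ← eVec_eq, ← eVec_eq,
      show n - 2 + 1 = n - 1 by omega, show 2 * n + 1 - (2 * n + 1 - k) = k by omega]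
    abel
  constructor
  · rintro (⟨i, j, h1, h2, h3⟩ | ⟨t, i, h1, h2, h3⟩ | ⟨t, i, h1, h2, h3, h4⟩ | ⟨i, k, h1, h2, h3⟩)
    · refine ⟨by simp [IsBox]; omega, ?_⟩
      rw [e1 i j h1 h2 (by omega)]
      simp [boxLabel, Nat.sub_add_cancel h1]
    · refine ⟨by simp [IsBox]; omega, ?_⟩
      rw [e1 i _ (by omega) (by omega) le_rfl]
      simp [boxLabel, Nat.sub_add_cancel (h1.trans h2), Nat.sub_add_cancel (show 1 ≤ n by omega)]
    · refine ⟨by simp [IsBox]; omega, ?_⟩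
      rw [e3 i h3 h4]
      simp [boxLabel, Nat.sub_add_cancel h3]
    · refine ⟨by simp [IsBox]; omega, ?_⟩
      rw [e4 i k h1 h2 h3]
      simp [boxLabel, Nat.sub_add_cancel h1, show 2 * n - 3 - k + 4 = 2 * n + 1 - k by omega]
  · obtain ⟨x, y, u, v⟩ := P
    rintro ⟨h, rfl⟩
    simp only [IsBox] at h
    rcases h with ⟨rfl, rfl, h1, h2⟩ | ⟨rfl, h1, h2, h3, rfl⟩ | ⟨rfl, h1, h2, h3, rfl⟩ |
      ⟨rfl, rfl, h1, h2⟩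
    · have := IsCorner.part1 (n := n) (x + 1) y (by omega) (by omega) h2
      rwa [e1 _ _ (by omega) (by omega) (by omega), Nat.add_sub_cancel] at this
    · have := IsCorner.part2 (n := n) v (x + 1) h1 h2 h3
      rwa [e1 _ _ (by omega) (by omega) (by omega), Nat.add_sub_cancel,
        Nat.sub_add_cancel (show 1 ≤ n by omega)] at this
    · have := IsCorner.part3 (n := n) v (x + 1) h1 h2 (by omega) h3
      rwa [e3 _ (by omega) (by omega), Nat.add_sub_cancel] at this
    · have := IsCorner.part4 (n := n) (x + 1) (2 * n - 3 - y) (by omega) (by omega) (by omega)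
      rwa [e4 _ _ (by omega) (by omega) (by omega), Nat.add_sub_cancel,
        show 2 * n - 3 - (2 * n - 3 - y) = y by omega,
        show 2 * n + 1 - (2 * n - 3 - y) = y + 4 by omega] at this

theorem mem_corners {n : ℕ} (hn : 3 ≤ n) {S : Set (E n)} {P : Vertex} :
    P ∈ corners n S ↔ IsBox n P ∧ ofInt (rootVec (boxLabel n P)) ∈ S := by
  simp only [corners, Set.Finite.mem_toFinset, Set.mem_ofPred_eq, isCorner_iff hn]
  constructor
  · rintro ⟨α, h1, h2, rfl⟩
    exact ⟨h2, h1⟩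
  · rintro ⟨h1, h2⟩
    exact ⟨_, h2, h1, rfl⟩

theorem boxLabel_mem {n : ℕ} (hn : 3 ≤ n) {P : Vertex} (h : IsBox n P) :
    boxLabel n P ∈ rootIndices n := by
  rw [mem_rootIndices]
  rcases h with ⟨h, h'⟩ | ⟨h, h'⟩ | ⟨h, h'⟩ | ⟨h, h'⟩ <;> simp [boxLabel, h] <;> omega

/-! ### Upper sets and antichains -/

section Upper

variable {α : Type*} [PartialOrder α]

open Classical in
/-- The upper sets of a finite subset of a poset. -/
noncomputable def upperSubsets (T : Finset α) : Finset (Finset α) :=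
  T.powerset.filter fun X => ∀ p ∈ X, ∀ q ∈ T, p ≤ q → q ∈ X

theorem mem_upperSubsets {T X : Finset α} :
    X ∈ upperSubsets T ↔ X ⊆ T ∧ ∀ p ∈ X, ∀ q ∈ T, p ≤ q → q ∈ X := by
  simp [upperSubsets]

/-- An upper set is recovered from its minimal elements, which form an antichain. -/
theorem card_upperSubsets (T : Finset α) : (upperSubsets T).card = (antichains T).card := by
  classical
  refine Finset.card_bij' (fun X _ => X.filter fun p => ∀ q ∈ X, q ≤ p → q = p)
    (fun A _ => T.filter fun q => ∃ p ∈ A, p ≤ q) ?_ ?_ ?_ ?_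
  · intro X hX
    rw [mem_upperSubsets] at hX
    rw [mem_antichains]
    refine ⟨(Finset.filter_subset _ _).trans hX.1, ?_⟩
    intro p hp q hq hpq hle
    simp only [Finset.coe_filter, Set.mem_ofPred_eq] at hp hq
    exact hpq (hq.2 p hp.1 hle)
  · intro A _
    rw [mem_upperSubsets]
    refine ⟨Finset.filter_subset _ _, ?_⟩
    intro p hp q hq hpq
    rw [Finset.mem_filter] at hp ⊢
    obtain ⟨r, hr, hrp⟩ := hp.2
    exact ⟨hq, r, hr, hrp.trans hpq⟩
  · intro X hX
    rw [mem_upperSubsets] at hX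
    ext q
    simp only [Finset.mem_filter]
    constructor
    · rintro ⟨hq, p, hp, hpq⟩
      exact hX.2 p hp.1 q hq hpq
    · intro hq
      obtain ⟨m, hm, hmin⟩ := X.exists_le_minimal hq
      exact ⟨hX.1 hq, m, ⟨hmin.prop, fun r hr hrm => hmin.eq_of_le hr hrm⟩, hm⟩
  · intro A hA
    rw [mem_antichains] at hA
    ext p
    simp only [Finset.mem_filter]
    constructor
    · rintro ⟨⟨hp, r, hr, hrp⟩, hmin⟩
      rw [← hmin r ⟨hA.1 hr, r, hr, le_rfl⟩ hrp]
      exact hr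
    · intro hp
      refine ⟨⟨hA.1 hp, p, hp, le_rfl⟩, ?_⟩
      rintro q ⟨hq, r, hr, hrq⟩ hqp
      have : r = p := by
        by_contra hne
        exact hA.2 hr hp hne (hrq.trans hqp)
      subst this
      exact le_antisymm hqp hrq

end Upper

/-! ### The regions in a Weyl cone -/

theorem IsPreconnected.lt_of_lt {X : Type*} [TopologicalSpace X] {S : Set X}
    (hS : IsPreconnected S) {f : X → ℝ} (hf : Continuous f) {c : ℝ} (hc : ∀ x ∈ S, f x ≠ c)
    {x x' : X} (hx : x ∈ S) (hx' : x' ∈ S) (h : c < f x) : c < f x' := by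
  by_contra hcon
  obtain ⟨z, hz, hzc⟩ := hS.intermediate_value hx' hx hf.continuousOn ⟨not_lt.1 hcon, h.le⟩
  exact hc z hz hzc

section Regions

variable {n : ℕ} (w : weylGroup n)

open Classical in
/-- The indices of the positive roots outside `N(w⁻¹)`. -/
noncomputable def nonInversions : Finset (RootIndex n) :=
  (rootIndices n).filter fun t => ofInt (rootVec t) ∉ inversionSet n w⁻¹

/-- The dominant points whose products with the roots outside `N(w⁻¹)` are greater than one exactly
at the roots in `X`. -/
def cell (X : Finset (RootIndex n)) : Set (E n) :=
  {y | y ∈ dominantCone n ∧ ∀ t ∈ nonInversions w,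
    (t ∈ X → 1 < ⟪ofInt (rootVec t), y⟫) ∧ (t ∉ X → ⟪ofInt (rootVec t), y⟫ < 1)}

variable {w}

theorem mem_nonInversions {t : RootIndex n} : t ∈ nonInversions w ↔
    t ∈ rootIndices n ∧ (w : E n ≃ₗᵢ[ℝ] E n) (ofInt (rootVec t)) ∈ posRoots n := by
  simp only [nonInversions, Finset.mem_filter]
  refine and_congr_right fun ht => ?_
  have hpos : ofInt (rootVec t) ∈ posRoots n := mem_posRoots.2 ⟨t, ht, rfl⟩
  have h1 : ofInt (rootVec t) ∈ inversionSet n w⁻¹ ↔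
      (w : E n ≃ₗᵢ[ℝ] E n) (ofInt (rootVec t)) ∈ negRoots n := by
    simp only [inversionSet, Set.mem_inter_iff, hpos, true_and, Set.mem_image]
    constructor
    · rintro ⟨v, hv, h⟩
      rw [← h, ← Function.comp_apply (f := (w : E n ≃ₗᵢ[ℝ] E n)), ← LinearIsometryEquiv.coe_mul,
        ← Subgroup.coe_mul, mul_inv_cancel]
      exact hv
    · intro hv
      refine ⟨_, hv, ?_⟩
      rw [← Function.comp_apply (f := ((w⁻¹ : weylGroup n) : E n ≃ₗᵢ[ℝ] E n)),
        ← LinearIsometryEquiv.coe_mul, ← Subgroup.coe_mul, inv_mul_cancel]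
      rfl
  rw [h1]
  have h2 := weylGroup_map_roots w.2 (v := ofInt (rootVec t)) (Or.inl hpos)
  refine ⟨fun h => h2.resolve_right h, fun h h' => ?_⟩
  obtain ⟨s, hs, h3⟩ := mem_posRoots.1 h
  obtain ⟨s', hs', h4⟩ := mem_posRoots.1 (show -_ ∈ posRoots n from h')
  rw [h3, ← ofInt_neg] at h4
  -- The height is positive on positive roots, so no root is both positive and negative.
  have h5 := height_rootVec_pos hs
  have h6 := height_rootVec_pos hs'
  rw [← ofInt_injective h4, map_neg] at h6
  omega

theorem inner_weyl (v y : E n) :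
    ⟪(w : E n ≃ₗᵢ[ℝ] E n) v, (w : E n ≃ₗᵢ[ℝ] E n) y⟫ = ⟪v, y⟫ :=
  LinearIsometryEquiv.inner_map_map _ _ _

theorem exists_preimage_root {α : E n} (hα : α ∈ posRoots n) : ∃ t ∈ rootIndices n,
    ((w : E n ≃ₗᵢ[ℝ] E n) (ofInt (rootVec t)) = α) ∨
      ((w : E n ≃ₗᵢ[ℝ] E n) (ofInt (rootVec t)) = -α) := by
  have h := weylGroup_map_roots (w⁻¹).2 (v := α) (Or.inl hα)
  have hw : (w : E n ≃ₗᵢ[ℝ] E n) (((w⁻¹ : weylGroup n) : E n ≃ₗᵢ[ℝ] E n) α) = α := by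
    rw [← Function.comp_apply (f := (w : E n ≃ₗᵢ[ℝ] E n)), ← LinearIsometryEquiv.coe_mul,
      ← Subgroup.coe_mul, mul_inv_cancel]
    rfl
  rcases h with h | h
  · obtain ⟨t, ht, h1⟩ := mem_posRoots.1 h
    exact ⟨t, ht, Or.inl (by rw [← h1, hw])⟩
  · obtain ⟨t, ht, h1⟩ := mem_posRoots.1 (show -_ ∈ posRoots n from h)
    exact ⟨t, ht, Or.inr (by rw [← h1, map_neg, hw])⟩

theorem mem_compl_shi {x : E n} :
    x ∈ (⋃₀ shiArrangement n)ᶜ ↔ ∀ α ∈ posRoots n, ⟪α, x⟫ ≠ 0 ∧ ⟪α, x⟫ ≠ 1 := by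
  simp only [shiArrangement, hyperplane, Set.mem_compl_iff, Set.mem_sUnion, Set.mem_ofPred_eq,
    not_exists, not_and]
  constructor
  · intro h α hα
    exact ⟨fun h0 => h _ ⟨α, hα, 0, by simp, rfl⟩ h0, fun h1 => h _ ⟨α, hα, 1, by simp, rfl⟩ h1⟩
  · rintro h _ ⟨α, hα, k, hk, rfl⟩ hx
    rcases hk with rfl | hk
    · exact (h α hα).1 hx
    · rw [Set.mem_singleton_iff] at hk
      subst hk
      exact (h α hα).2 hx

theorem inner_pos_of_dominant {y : E n} (hy : y ∈ dominantCone n) {t : RootIndex n}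
    (ht : t ∈ rootIndices n) : 0 < ⟪ofInt (rootVec t), y⟫ :=
  hy _ (mem_posRoots.2 ⟨t, ht, rfl⟩)

/-- A positive root α with w⁻¹α negative is negative on C_w, so its value is neither 0 nor 1; every
other α comes from a member of T. -/
theorem image_cell_subset_compl (X : Finset (RootIndex n)) :
    (w : E n ≃ₗᵢ[ℝ] E n) '' cell w X ⊆ (⋃₀ shiArrangement n)ᶜ := by
  rintro _ ⟨y, ⟨hy, hX⟩, rfl⟩
  rw [mem_compl_shi]
  intro α hα
  obtain ⟨t, ht, h | h⟩ := exists_preimage_root (w := w) hα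
  · have htT : t ∈ nonInversions w := mem_nonInversions.2 ⟨ht, h ▸ hα⟩
    have h0 := inner_pos_of_dominant hy ht
    rw [← h, inner_weyl]
    refine ⟨h0.ne', ?_⟩
    by_cases htX : t ∈ X
    · exact ((hX t htT).1 htX).ne'
    · exact ((hX t htT).2 htX).ne
  · have h0 := inner_pos_of_dominant hy ht
    have h1 : ⟪α, (w : E n ≃ₗᵢ[ℝ] E n) y⟫ = -⟪ofInt (rootVec t), y⟫ := by
      rw [← inner_weyl (w := w) (ofInt (rootVec t)), h, inner_neg_left, neg_neg]
    rw [h1]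
    exact ⟨by linarith, by linarith⟩

theorem convex_cell (X : Finset (RootIndex n)) : Convex ℝ (cell w X) := by
  intro y hy z hz a b ha hb hab
  have key : ∀ (v : E n) (c : ℝ), (c < ⟪v, y⟫ → c < ⟪v, z⟫ → c < ⟪v, a • y + b • z⟫) ∧
      (⟪v, y⟫ < c → ⟪v, z⟫ < c → ⟪v, a • y + b • z⟫ < c) := by
    intro v c
    have h1 : ⟪v, a • y + b • z⟫ = a * ⟪v, y⟫ + b * ⟪v, z⟫ := by
      rw [inner_add_right, inner_smul_right, inner_smul_right]
    rw [h1]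
    constructor
    · intro h2 h3
      exact (convex_Ioi c) h2 h3 ha hb hab
    · intro h2 h3
      exact (convex_Iio c) h2 h3 ha hb hab
  refine ⟨fun α hα => (key α 0).1 (hy.1 α hα) (hz.1 α hα), fun t ht => ⟨fun h => ?_, fun h => ?_⟩⟩
  · exact (key _ 1).1 ((hy.2 t ht).1 h) ((hz.2 t ht).1 h)
  · exact (key _ 1).2 ((hy.2 t ht).2 h) ((hz.2 t ht).2 h)

/-- No strict inequality defining the cell can change on a connected set that avoids the
hyperplanes; conversely, the cell is convex and hence connected. -/
theorem connectedComponentIn_eq_image_cell {X : Finset (RootIndex n)} {x : E n}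
    (hx : x ∈ (w : E n ≃ₗᵢ[ℝ] E n) '' cell w X) :
    connectedComponentIn (⋃₀ shiArrangement n)ᶜ x = (w : E n ≃ₗᵢ[ℝ] E n) '' cell w X := by
  have hsub := image_cell_subset_compl (w := w) X
  apply subset_antisymm
  · obtain ⟨y, hy, rfl⟩ := hx
    intro x' hx'
    set S := connectedComponentIn (⋃₀ shiArrangement n)ᶜ ((w : E n ≃ₗᵢ[ℝ] E n) y) with hS
    have hpre : IsPreconnected S := isPreconnected_connectedComponentIn
    have hSU : S ⊆ (⋃₀ shiArrangement n)ᶜ := connectedComponentIn_subset _ _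
    have hyS : (w : E n ≃ₗᵢ[ℝ] E n) y ∈ S := mem_connectedComponentIn (hsub ⟨y, hy, rfl⟩)
    obtain ⟨y', rfl⟩ := (w : E n ≃ₗᵢ[ℝ] E n).surjective x'
    refine ⟨y', ?_, rfl⟩
    have hcont : ∀ v : E n, Continuous fun x : E n => ⟪v, x⟫ := fun v => by fun_prop
    have hne : ∀ t ∈ rootIndices n, ∀ x ∈ S,
        ⟪(w : E n ≃ₗᵢ[ℝ] E n) (ofInt (rootVec t)), x⟫ ≠ 0 := by
      intro t ht x hx
      have h := weylGroup_map_roots w.2 (v := ofInt (rootVec t))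
        (Or.inl (mem_posRoots.2 ⟨t, ht, rfl⟩))
      rcases h with h | h
      · exact (mem_compl_shi.1 (hSU hx) _ h).1
      · have := (mem_compl_shi.1 (hSU hx) _ h).1
        rwa [inner_neg_left, neg_ne_zero] at this
    have hne1 : ∀ t ∈ nonInversions w, ∀ x ∈ S,
        ⟪(w : E n ≃ₗᵢ[ℝ] E n) (ofInt (rootVec t)), x⟫ ≠ 1 := by
      intro t ht x hx
      exact (mem_compl_shi.1 (hSU hx) _ (mem_nonInversions.1 ht).2).2
    constructor
    · intro α hα
      obtain ⟨t, ht, rfl⟩ := mem_posRoots.1 hα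
      have := IsPreconnected.lt_of_lt hpre (hcont _) (hne t ht) hyS hx'
        (by rw [inner_weyl]; exact inner_pos_of_dominant hy.1 ht)
      rwa [inner_weyl] at this
    · intro t ht
      constructor
      · intro htX
        have := IsPreconnected.lt_of_lt hpre (hcont _) (hne1 t ht) hyS hx'
          (by rw [inner_weyl]; exact (hy.2 t ht).1 htX)
        rwa [inner_weyl] at this
      · intro htX
        have := IsPreconnected.lt_of_lt hpre (hcont _).neg (c := -1)
          (fun x hx h => hne1 t ht x hx (neg_injective h)) hyS hx'
          (by
            simp only [Pi.neg_apply, inner_weyl, neg_lt_neg_iff]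
            exact (hy.2 t ht).2 htX)
        simpa [inner_weyl] using this
  · refine IsPreconnected.subset_connectedComponentIn ?_ hx hsub
    exact (convex_cell X).isPreconnected.image _
      (w : E n ≃ₗᵢ[ℝ] E n).continuous.continuousOn

/-- The upper set that X generates among all positive roots adds no further member of T, so a
dominant point realizing it lies in the cell. -/
theorem cell_nonempty {X : Finset (RootIndex n)} (hX : X ∈ upperSubsets (nonInversions w)) :
    (cell w X).Nonempty := by
  rw [mem_upperSubsets] at hX
  obtain ⟨y, hy⟩ := exists_dominant_point {q | q ∈ rootIndices n ∧ ∃ p ∈ X, p ≤ q}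
    (by
      rintro p ⟨hp, r, hr, hrp⟩ q hq hpq
      exact ⟨hq, r, hr, hrp.trans hpq⟩)
    (fun q hq => hq.1)
  refine ⟨WithLp.toLp 2 y, ?_, ?_⟩
  · intro α hα
    obtain ⟨t, ht, rfl⟩ := mem_posRoots.1 hα
    rw [inner_ofInt]
    exact (hy t ht).1
  · intro t ht
    have ht' := (mem_nonInversions.1 ht).1
    rw [inner_ofInt]
    refine ⟨fun h => (hy t ht').2.1 ⟨ht', t, h, le_rfl⟩, fun h => (hy t ht').2.2 ?_⟩
    rintro ⟨_, p, hp, hpt⟩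
    exact h (hX.2 p hp t ht hpt)

theorem regionsInCone_eq (w : weylGroup n) : regionsInCone n w =
    (fun X => (w : E n ≃ₗᵢ[ℝ] E n) '' cell w X) '' (upperSubsets (nonInversions w) : Set _) := by
  classical
  ext R
  constructor
  · rintro ⟨⟨x, hx, rfl⟩, hsub⟩
    obtain ⟨y, hy, rfl⟩ := hsub (mem_connectedComponentIn hx)
    have hne : ∀ t ∈ nonInversions w, ⟪ofInt (rootVec t), y⟫ ≠ 1 := by
      intro t ht
      have := (mem_compl_shi.1 hx _ (mem_nonInversions.1 ht).2).2
      rwa [inner_weyl] at this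
    refine ⟨(nonInversions w).filter fun t => 1 < ⟪ofInt (rootVec t), y⟫, ?_, ?_⟩
    · rw [Finset.mem_coe, mem_upperSubsets]
      refine ⟨Finset.filter_subset _ _, ?_⟩
      intro p hp q hq hpq
      rw [Finset.mem_filter] at hp ⊢
      exact ⟨hq, hp.2.trans_le (inner_le_of_le hy (mem_nonInversions.1 hp.1).1
        (mem_nonInversions.1 hq).1 hpq)⟩
    · refine (connectedComponentIn_eq_image_cell ⟨y, ⟨hy, fun t ht => ?_⟩, rfl⟩).symm
      simp only [Finset.mem_filter, ht, true_and, imp_self, not_lt]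
      exact fun h => lt_of_le_of_ne h (hne t ht)
  · rintro ⟨X, hX, rfl⟩
    obtain ⟨y, hy⟩ := cell_nonempty hX
    refine ⟨⟨(w : E n ≃ₗᵢ[ℝ] E n) y, image_cell_subset_compl X ⟨y, hy, rfl⟩, ?_⟩, ?_⟩
    · exact (connectedComponentIn_eq_image_cell ⟨y, hy, rfl⟩).symm
    · exact Set.image_mono fun y hy => hy.1

theorem regionsInCone_finite (w : weylGroup n) : (regionsInCone n w).Finite := by
  rw [regionsInCone_eq]
  exact (upperSubsets (nonInversions w)).finite_toSet.image _

theorem ncard_regionsInCone (w : weylGroup n) :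
    (regionsInCone n w).ncard = (antichains (nonInversions w)).card := by
  rw [regionsInCone_eq, Set.InjOn.ncard_image, Set.ncard_coe_finset, card_upperSubsets]
  intro X hX X' hX' h
  have h' : cell w X = cell w X' :=
    Set.image_injective.2 (w : E n ≃ₗᵢ[ℝ] E n).injective h
  obtain ⟨y, hy⟩ := cell_nonempty hX
  have hy' := h' ▸ hy
  have h1 := (mem_upperSubsets.1 hX).1
  have h2 := (mem_upperSubsets.1 hX').1
  ext t
  constructor
  · intro ht
    by_contra hcon
    exact lt_asymm ((hy.2 t (h1 ht)).1 ht) ((hy'.2 t (h1 ht)).2 hcon)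
  · intro ht
    by_contra hcon
    exact lt_asymm ((hy'.2 t (h2 ht)).1 ht) ((hy.2 t (h2 ht)).2 hcon)

end Regions

/-! ### The main theorem -/

theorem isVertex_source {n : ℕ} (hn : 3 ≤ n) : IsVertex n source := by
  simp [IsVertex, source]
  omega

theorem IsBox.isVertex_tr {n : ℕ} (hn : 3 ≤ n) {P : Vertex} (h : IsBox n P) : IsVertex n P.tr := by
  simp only [IsBox, IsVertex, Vertex.tr] at h ⊢
  omega

theorem pathCount_eq_gammaFormula {n : ℕ} (hn : 3 ≤ n) {P Q : Vertex}
    (hP : P = source ∨ ∃ C, IsBox n C ∧ P = C.tr) (hQ : Q = sink n ∨ IsBox n Q) :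
    pathCount n P Q = gammaFormula n P Q := by
  have hP' : IsVertex n P := by
    rcases hP with rfl | ⟨C, hC, rfl⟩
    exacts [isVertex_source hn, hC.isVertex_tr hn]
  rw [← count_eq_gammaFormula hn hP hQ,
    (pathRec_count hn hQ).eq_sum hn {Q} (fun R hR => if_neg (by simpa using hR)) hP']
  simp

theorem sink_not_isBox {n : ℕ} (hn : 3 ≤ n) : ¬ IsBox n (sink n) := by
  simp [IsBox, sink]
  omega

theorem ncard_regionsInCone_eq_det {n : ℕ} (hn : 3 ≤ n) (w : weylGroup n) :
    ((regionsInCone n w).ncard : ℤ) =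
      (cornerMatrix n (corners n (inversionSet n w⁻¹)) (pathCount n)).det := by
  classical
  set C := corners n (inversionSet n w⁻¹) with hCdef
  set T := nonInversions w with hTdef
  have hT : T ⊆ rootIndices n := fun t ht => (mem_nonInversions.1 ht).1
  have hC : ∀ P, P ∈ C ↔ IsBox n P ∧ boxLabel n P ∉ T := by
    intro P
    rw [hCdef, mem_corners hn, hTdef, nonInversions]
    refine and_congr_right fun hP => ?_
    simp [boxLabel_mem hn hP]
  have hsink : sink n ∉ C := fun h => sink_not_isBox hn ((hC _).1 h).1
  have hrec := pathRec_antichainCount hn hT hC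
  -- Every positive root has a ≥ 1 and b ≥ 2, so all of T is ahead of I = (0, 1).
  have hsrc : antichainCount T (IsAhead n source) = (regionsInCone n w).ncard := by
    rw [ncard_regionsInCone, antichainCount, Finset.filter_true_of_mem]
    intro t ht
    have := mem_rootIndices.1 (hT ht)
    simp [IsAhead, source]
    omega
  rw [← hsrc, det_cornerMatrix n (remaining n) C (pathCount n) ?_
    (fun P Q h => pathCount_eq_zero hn h) (fun P => antichainCount T (IsAhead n P))]
  · intro P hP
    have hP' : IsVertex n P := by
      rcases hP with rfl | ⟨Q, hQ, rfl⟩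
      exacts [isVertex_source hn, ((hC Q).1 hQ).1.isVertex_tr hn]
    -- The source terms are 1 at F and -c(Q.tr) at the corners Q, which gives the linear system
    -- required by `det_cornerMatrix`.
    rw [hrec.eq_sum hn (insert (sink n) C) ?_ hP', Finset.sum_insert hsink]
    · rw [if_pos rfl, if_neg hsink, sub_zero, mul_one, sub_eq_add_neg, ← Finset.sum_neg_distrib]
      congr 1
      refine Finset.sum_congr rfl fun Q hQ => ?_
      have : Q ≠ sink n := fun h => hsink (h ▸ hQ)
      simp [this, hQ]
    · intro Q hQ
      rw [Finset.mem_insert, not_or] at hQ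
      simp [hQ.1, hQ.2]
  · intro P hP
    exact ((isCorner_iff hn).2 ⟨((hC P).1 hP).1, rfl⟩).remaining_tr_lt hn

end ShiD
theorem mainTheorem4 (n : ℕ) (hn : 3 ≤ n) (w : ShiD.weylGroup n) :
    -- the number of Shi regions in the cone is the determinant of the matrix of path counts
    (ShiD.regionsInCone n w).Finite ∧
    ((ShiD.regionsInCone n w).ncard : ℤ) =
      (ShiD.cornerMatrix n (ShiD.corners n (ShiD.inversionSet n w⁻¹))
        (ShiD.pathCount n)).det ∧
    -- the same determinant with the explicit formula for the entries
    ((ShiD.regionsInCone n w).ncard : ℤ) =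
      (ShiD.cornerMatrix n (ShiD.corners n (ShiD.inversionSet n w⁻¹))
        (ShiD.gammaFormula n)).det ∧
    -- the explicit formula gives the path counts
    (∀ P Q : ShiD.Vertex,
      (P = ShiD.source ∨ ∃ C ∈ ShiD.corners n (ShiD.posRoots n), P = C.tr) →
      (Q = ShiD.sink n ∨ Q ∈ ShiD.corners n (ShiD.posRoots n)) →
      (ShiD.paths (ShiD.Gamma n) P Q).Finite ∧
      ShiD.pathCount n P Q = ShiD.gammaFormula n P Q) := by
  have hbox : ∀ {S : Set (ShiD.E n)} {P}, P ∈ ShiD.corners n S → ShiD.IsBox n P := fun h =>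
    ((ShiD.mem_corners hn).1 h).1
  refine ⟨ShiD.regionsInCone_finite w, ShiD.ncard_regionsInCone_eq_det hn w, ?_, ?_⟩
  · rw [ShiD.ncard_regionsInCone_eq_det hn w]
    congr 1
    ext r c
    rcases r with _ | r <;> rcases c with _ | c <;> simp only [ShiD.cornerMatrix]
    · exact ShiD.pathCount_eq_gammaFormula hn (Or.inl rfl) (Or.inl rfl)
    · exact ShiD.pathCount_eq_gammaFormula hn (Or.inr ⟨_, hbox c.2, rfl⟩) (Or.inl rfl)
    · exact ShiD.pathCount_eq_gammaFormula hn (Or.inl rfl) (Or.inr (hbox r.2))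
    · rw [ShiD.pathCount_eq_gammaFormula hn (Or.inr ⟨_, hbox c.2, rfl⟩) (Or.inr (hbox r.2))]
  · intro P Q hP hQ
    refine ⟨ShiD.finite_paths_Gamma n hn P Q, ShiD.pathCount_eq_gammaFormula hn ?_ ?_⟩
    · exact hP.imp_right fun ⟨C, hC, h⟩ => ⟨C, hbox hC, h⟩
    · exact hQ.imp_right hbox
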